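/- Let $\mathcal T$ be a locally finite rooted tree with root $v_0$, vertex set $\mathcal V$ and edges oriented away from the root ($o(e)$, $t(e)$ denote origin and terminus of an edge $e$). A *colouring structure* $\mathscr C=(L,\ell,\mathcal D,\operatorname{ccol})$ on $\mathcal T$ consists of a finite set $L$ of labels; a labelling $\ell\colon\mathcal V\setminus\{v_0\}\to L$ such that any two vertices with the same label admit a label-preserving bijection between their sets of children, and such that for every $l\in L$ the set $\ell^{-1}(l)$ is not contained in any proper subtree of $\mathcal T$ containing $v_0$; pairwise disjoint finite sets $D_{l,l'}$ $(l,l'\in L)$ of colours; and a map $\operatorname{ccol}$ from the set of edges that do not start at $v_0$ to $\bigsqcup_{l,l'}D_{l,l'}$ which, for every vertex $v\neq v_0$ and every $l'\in L$, restricts to a bijection from the set of edges from $v$ to children with label $l'$ onto $D_{\ell(v),l'}$. A *patterning* $\mathscr P$ is a colouring structure together with subgroups $F_l\le\operatorname{Sym}(D_l)$, $D_l=\bigsqcup_{l'}D_{l,l'}$, for $l\in L$, such that every element of $F_l$ maps each $D_{l,l'}$ to itself. A finite subtree $T$ is *complete* if it contains $v_0$ and contains, with each of its vertices, either all or none of the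 children of that vertex; $\mathcal T\setminus T$ is the forest formed by the leaves of $T$ and all their descendants. An *almost automorphism* of $\mathcal T$ is an equivalence class of forest isomorphisms $\varphi\colon\mathcal T\setminus T_1\to\mathcal T\setminus T_2$ with $T_1,T_2$ finite complete subtrees, where two such maps are equivalent if they agree on $\mathcal T\setminus T$ for some finite complete subtree $T$ containing both of the subtrees removed from their domains. Under composition of suitable representatives they form a group $\operatorname{AAut}(\mathcal T)$. In the following, representatives are required to map non-root vertices to non-root vertices and, if the root lies in the domain, the root to itself. Let $V_{\mathscr C}$ be the subgroup of the almost automorphisms that have a representative $\varphi$ with $\operatorname{ccol}(\varphi(e))=\operatorname{ccol}(e)$ for all edges $e$ of its domain not starting at $v_0$. Let $\operatorname{AAut}_{\mathscr P}(\mathcal T)$ be the subgroup of the almost automorphisms that have a *$\mathscr P$-patterning* representative $\varphi$, that is, one such that for every vertex $v\ne v_0$ of its domain $\ell(\varphi(v))=\ell(v)$ and the local permutation $\operatorname{ccol}\circ\varphi\circ\operatorname{ccol}^{-1}$ of $D_{\ell(v)}$ at $v$ belongs to $F_{\ell(v)}$. Let $\operatorname{Aut}_{\mathscr P}(\mathcal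 T)$ be the group of the rooted-tree automorphisms that satisfy the last condition at every vertex $v\neq v_0$. The group $\operatorname{AAut}_{\mathscr P}(\mathcal T)$ carries the group topology for which $\operatorname{Aut}_{\mathscr P}(\mathcal T)$, with the topology of pointwise convergence on $\mathcal V$, is an open subgroup; that is, the pointwise stabilizers in $\operatorname{Aut}_{\mathscr P}(\mathcal T)$ of finite sets of vertices form a neighbourhood basis of the identity. **Proposition.** Let $\mathcal T$ be a locally finite rooted tree with a colouring structure $\mathscr C$ and a patterning $\mathscr P=(\mathscr C,(F_l)_{l\in L})$, and assume that $\mathcal T$ is non-circular, that is, some vertex different from the root has at least two children. Writing $D(G)$ for the commutator subgroup of a group $G$ and taking closures in $\operatorname{AAut}_{\mathscr P}(\mathcal T)$, we have $$\overline{D(\operatorname{AAut}_{\mathscr P}(\mathcal T))}=\overline{D(V_{\mathscr C})},$$ and this group is topologically simple: it is non-trivial, and its only closed normal subgroups are the trivial group and the whole group. -/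

import Mathlib

universe u v w

open Set

/-! Rooted trees are Mathlib's `RootedTree`s: `v ≤ w` means that `w` is a descendant of `v` (or `v`
itself), `⊥` is the root, and `v ⋖ w` means that `w` is a child of `v`.  The edge from `v` to its
child `w` is represented by its terminus `w`. -/

namespace RootedTree

/-- The set of children of a vertex. -/
def children (T : RootedTree.{u}) (x : T) : Set T := {y | x ⋖ y}

/-- Every vertex has finitely many children. -/
class IsLocallyFinite (T : RootedTree.{u}) : Prop where
  finite_children : ∀ x : T, (T.children x).Finite

/-- A finite complete subtree: a finite subtree that contains the root and contains, with each of its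
vertices, either all or none of the children of that vertex. (The vertex sets of the subtrees that
contain the root are the nonempty lower sets.) -/
structure CompleteSubtree (T : RootedTree.{u}) where
  carrier : Set T
  finite : carrier.Finite
  bot_mem : ⊥ ∈ carrier
  isLowerSet : IsLowerSet carrier
  complete : ∀ x ∈ carrier, T.children x ⊆ carrier ∨ Disjoint (T.children x) carrier

/-- The leaves of a finite complete subtree. -/
def CompleteSubtree.leaves {T : RootedTree.{u}} (S : CompleteSubtree T) : Set T :=
  {x | x ∈ S.carrier ∧ Disjoint (T.children x) S.carrier}

/-- The vertex set of the forest `T \ S`: the union of the trees of descendants of the leaves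
of `S`. -/
def CompleteSubtree.forest {T : RootedTree.{u}} (S : CompleteSubtree T) : Set T :=
  ⋃ x ∈ S.leaves, Set.Ici x

/-- An honest almost automorphism: an isomorphism of forests `T \ S₁ → T \ S₂`, for finite complete
subtrees `S₁`, `S₂`. It is a bijection between the vertex sets that preserves and reflects the
descendant relation. The values outside of `source` and `target` are irrelevant. -/
structure HonestAAut (T : RootedTree.{u}) extends PartialEquiv T T where
  source_eq : ∃ S : CompleteSubtree T, source = S.forest
  target_eq : ∃ S : CompleteSubtree T, target = S.forest
  le_iff : ∀ x ∈ source, ∀ y ∈ source, toFun x ≤ toFun y ↔ x ≤ y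

section Basic

variable {T : RootedTree.{u}}

theorem tree_induction {p : T → Prop} (h0 : p ⊥) (hs : ∀ x y : T, x ⋖ y → p x → p y) (x : T) :
    p x := by
  obtain ⟨n, hn⟩ := (bot_le (a := x)).exists_pred_iterate
  induction n generalizing x with
  | zero => simp at hn; rw [hn]; exact h0
  | succ n ih =>
    rw [Function.iterate_succ_apply] at hn
    by_cases hx : x = ⊥
    · rw [hx]; exact h0
    · exact hs _ _ (Order.pred_covBy_of_not_isMin (by simpa using hx)) (ih _ hn)

theorem le_of_lt_covBy {x y z : T} (h : y ⋖ z) (hx : x < z) : x ≤ y := by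
  have := Order.le_pred_of_lt hx
  rwa [h.pred_eq] at this

theorem exists_child_of_lt {x y : T} (h : x < y) : ∃ z, x ⋖ z ∧ z ≤ y := by
  revert h
  refine tree_induction (p := fun y => x < y → ∃ z, x ⋖ z ∧ z ≤ y) (by simp) ?_ y
  intro a b hab ih hxb
  rcases (le_of_lt_covBy hab hxb).eq_or_lt with rfl | hlt
  · exact ⟨b, hab, le_rfl⟩
  · obtain ⟨z, hz, hza⟩ := ih hlt
    exact ⟨z, hz, hza.trans hab.le⟩

theorem exists_minimal_le {s : Set T} {x : T} (hx : x ∈ s) :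
    ∃ z ∈ s, z ≤ x ∧ ∀ y, y ⋖ z → y ∉ s := by
  revert hx
  refine tree_induction (p := fun x => x ∈ s → ∃ z ∈ s, z ≤ x ∧ ∀ y, y ⋖ z → y ∉ s) ?_ ?_ x
  · intro h
    exact ⟨⊥, h, le_rfl, fun y hy => absurd hy.lt (by simp)⟩
  · intro a b hab ih hb
    by_cases ha : a ∈ s
    · obtain ⟨z, hz, hza, hm⟩ := ih ha
      exact ⟨z, hz, hza.trans hab.le, hm⟩
    · refine ⟨b, hb, le_rfl, fun y hy => ?_⟩
      rwa [← hy.pred_eq, hab.pred_eq]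

/-- The forests `T \ S` are the upper sets with finite complement that contain all childless
vertices. -/
theorem isForest_iff [T.IsLocallyFinite] {s : Set T} :
    (∃ S : CompleteSubtree T, s = S.forest) ↔
      IsUpperSet s ∧ sᶜ.Finite ∧ ∀ x, x ∉ s → (T.children x).Nonempty := by
  constructor
  · rintro ⟨S, rfl⟩
    have hup : IsUpperSet S.forest := by
      intro a b hab ha
      simp only [CompleteSubtree.forest, mem_iUnion, mem_Ici, exists_prop] at ha ⊢
      obtain ⟨x, hx, hxa⟩ := ha
      exact ⟨x, hx, hxa.trans hab⟩
    have hleaf : ∀ x ∈ S.leaves, x ∈ S.forest := by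
      intro x hx
      simp only [CompleteSubtree.forest, mem_iUnion, mem_Ici, exists_prop]
      exact ⟨x, hx, le_rfl⟩
    have hor : ∀ x : T, x ∈ S.carrier ∨ x ∈ S.forest := by
      refine tree_induction (Or.inl S.bot_mem) ?_
      rintro x y hxy (h | h)
      · rcases S.complete x h with h' | h'
        · exact Or.inl (h' hxy)
        · exact Or.inr (hup hxy.le (hleaf x ⟨h, h'⟩))
      · exact Or.inr (hup hxy.le h)
    refine ⟨hup, S.finite.subset fun x hx => (hor x).resolve_right hx, fun x hx => ?_⟩
    have hc := (hor x).resolve_right hx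
    by_contra hne
    rw [not_nonempty_iff_eq_empty] at hne
    exact hx (hleaf x ⟨hc, by simp [hne]⟩)
  · rintro ⟨hup, hfin, hch⟩
    refine ⟨⟨sᶜ ∪ {⊥} ∪ ⋃ x ∈ sᶜ, T.children x, ?_, ?_, ?_, ?_⟩, ?_⟩
    · exact (hfin.union (finite_singleton _)).union
        (hfin.biUnion fun x _ => IsLocallyFinite.finite_children x)
    · simp
    · intro a b hba ha
      rcases ha with (ha | ha) | ha
      · exact Or.inl (Or.inl fun hb => ha (hup hba hb))
      · rw [mem_singleton_iff] at ha
        subst ha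
        exact Or.inl (Or.inr (by simpa using hba))
      · rcases hba.eq_or_lt with rfl | hlt
        · exact Or.inr ha
        · simp only [mem_iUnion, exists_prop] at ha
          obtain ⟨x, hx, hxa⟩ := ha
          exact Or.inl (Or.inl fun hb => hx (hup (le_of_lt_covBy hxa hlt) hb))
    · intro x _
      by_cases hx : x ∈ s
      · right
        rw [Set.disjoint_left]
        intro y hxy hy
        rcases hy with (hy | hy) | hy
        · exact hy (hup hxy.le hx)
        · rw [mem_singleton_iff] at hy
          subst hy
          exact absurd (CovBy.lt hxy) (by simp)
        · simp only [mem_iUnion, exists_prop] at hy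
          obtain ⟨z, hz, hzy⟩ := hy
          have : z = x := by rw [← CovBy.pred_eq hzy, ← CovBy.pred_eq hxy]
          exact hz (this ▸ hx)
      · left
        intro y hy
        exact Or.inr (mem_biUnion (show x ∈ sᶜ from hx) hy)
    · ext x
      simp only [CompleteSubtree.forest, CompleteSubtree.leaves, mem_iUnion, mem_Ici, exists_prop]
      constructor
      · intro hx
        obtain ⟨z, hz, hzx, hm⟩ := exists_minimal_le hx
        refine ⟨z, ⟨?_, ?_⟩, hzx⟩
        · by_cases hz0 : z = ⊥
          · exact Or.inl (Or.inr hz0)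
          · have hc := Order.pred_covBy_of_not_isMin (a := z) (by simpa using hz0)
            exact Or.inr (mem_biUnion (show Order.pred z ∈ sᶜ from hm _ hc) hc)
        · rw [Set.disjoint_left]
          intro y hxy hy
          rcases hy with (hy | hy) | hy
          · exact hy (hup hxy.le hz)
          · rw [mem_singleton_iff] at hy
            subst hy
            exact absurd (CovBy.lt hxy) (by simp)
          · simp only [mem_iUnion, exists_prop] at hy
            obtain ⟨a, ha, hay⟩ := hy
            have : a = z := by rw [← CovBy.pred_eq hay, ← CovBy.pred_eq hxy]
            exact ha (this ▸ hz)
      · rintro ⟨z, ⟨_, hd⟩, hzx⟩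
        refine hup hzx ?_
        by_contra hz
        obtain ⟨y, hy⟩ := hch z hz
        exact Set.disjoint_left.1 hd hy (Or.inr (mem_biUnion (show z ∈ sᶜ from hz) hy))

namespace HonestAAut

theorem isUpperSet_source [T.IsLocallyFinite] (φ : HonestAAut T) : IsUpperSet φ.source :=
  (isForest_iff.1 φ.source_eq).1

theorem isUpperSet_target [T.IsLocallyFinite] (φ : HonestAAut T) : IsUpperSet φ.target :=
  (isForest_iff.1 φ.target_eq).1

/-- The inverse of an honest almost automorphism. -/
def symm (φ : HonestAAut T) : HonestAAut T where
  toPartialEquiv := φ.toPartialEquiv.symm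
  source_eq := φ.target_eq
  target_eq := φ.source_eq
  le_iff x hx y hy := by
    have := φ.le_iff _ (φ.map_target hx) _ (φ.map_target hy)
    change φ.toPartialEquiv (φ.toPartialEquiv.symm x) ≤
      φ.toPartialEquiv (φ.toPartialEquiv.symm y) ↔ _ at this
    rw [φ.right_inv hx, φ.right_inv hy] at this
    exact this.symm

theorem isForest_preimage [T.IsLocallyFinite] (φ : HonestAAut T) {s t : Set T}
    (ht : ∃ S : CompleteSubtree T, t = S.forest) (hts : t ⊆ φ.source)
    (hs : ∃ S : CompleteSubtree T, s = S.forest) :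
    ∃ S : CompleteSubtree T, t ∩ φ.toPartialEquiv ⁻¹' s = S.forest := by
  rw [isForest_iff] at *
  obtain ⟨tu, tf, tc⟩ := ht
  obtain ⟨su, sf, sc⟩ := hs
  refine ⟨?_, ?_, ?_⟩
  · rintro a b hab ⟨ha, ha'⟩
    have hb := tu hab ha
    exact ⟨hb, su ((φ.le_iff a (hts ha) b (hts hb)).2 hab) ha'⟩
  · have : (t ∩ φ.toPartialEquiv ⁻¹' s)ᶜ ⊆ tᶜ ∪ φ.toPartialEquiv.symm '' sᶜ := by
      intro x hx
      by_cases hxt : x ∈ t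
      · right
        refine ⟨φ.toPartialEquiv x, fun h => hx ⟨hxt, h⟩, φ.left_inv (hts hxt)⟩
      · exact Or.inl hxt
    exact (tf.union (sf.image _)).subset this
  · intro x hx
    by_cases hxt : x ∈ t
    · obtain ⟨y, hy⟩ := sc (φ.toPartialEquiv x) fun h => hx ⟨hxt, h⟩
      have hyt : y ∈ φ.target := φ.isUpperSet_target (CovBy.le hy) (φ.map_source (hts hxt))
      have h1 : x ≤ φ.toPartialEquiv.symm y := by
        rw [← φ.le_iff x (hts hxt) _ (φ.map_target hyt)]
        rw [φ.right_inv hyt]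
        exact CovBy.le hy
      have h2 : x ≠ φ.toPartialEquiv.symm y := by
        intro h
        apply (CovBy.lt hy).ne
        conv_rhs => rw [← φ.right_inv hyt, ← h]
      obtain ⟨z, hz, _⟩ := exists_child_of_lt (lt_of_le_of_ne h1 h2)
      exact ⟨z, hz⟩
    · exact tc x hxt

/-- The composition `φ ∘ ψ` of honest almost automorphisms, defined on the largest possible
forest. -/
def comp [T.IsLocallyFinite] (φ ψ : HonestAAut T) : HonestAAut T where
  toPartialEquiv := ψ.toPartialEquiv.trans φ.toPartialEquiv
  source_eq := ψ.isForest_preimage ψ.source_eq subset_rfl φ.source_eq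
  target_eq := φ.symm.isForest_preimage φ.target_eq subset_rfl ψ.target_eq
  le_iff x hx y hy := by
    rw [← ψ.le_iff x hx.1 y hy.1]
    exact φ.le_iff _ hx.2 _ hy.2

/-- An automorphism of the rooted tree as an honest almost automorphism. -/
def ofAut [T.IsLocallyFinite] (α : T ≃o T) : HonestAAut T where
  toPartialEquiv := α.toEquiv.toPartialEquiv
  source_eq := isForest_iff.2 (by simp [isUpperSet_univ])
  target_eq := isForest_iff.2 (by simp [isUpperSet_univ])
  le_iff x _ y _ := α.le_iff_le

/-- Honest almost automorphisms are equivalent if they are both defined, and agree, on `T \ S` for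
some finite complete subtree `S`. -/
def Equivalent (φ ψ : HonestAAut T) : Prop :=
  ∃ S : CompleteSubtree T, S.forest ⊆ φ.source ∩ ψ.source ∧
    EqOn φ.toPartialEquiv ψ.toPartialEquiv S.forest

theorem equivalent_iff {φ ψ : HonestAAut T} : Equivalent φ ψ ↔
    ∃ s : Set T, (∃ S : CompleteSubtree T, s = S.forest) ∧ s ⊆ φ.source ∩ ψ.source ∧
      EqOn φ.toPartialEquiv ψ.toPartialEquiv s := by
  constructor
  · rintro ⟨S, h⟩
    exact ⟨_, ⟨S, rfl⟩, h⟩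
  · rintro ⟨_, ⟨S, rfl⟩, h⟩
    exact ⟨S, h⟩

theorem isForest_inter [T.IsLocallyFinite] {s t : Set T}
    (hs : ∃ S : CompleteSubtree T, s = S.forest) (ht : ∃ S : CompleteSubtree T, t = S.forest) :
    ∃ S : CompleteSubtree T, s ∩ t = S.forest := by
  simpa [ofAut] using (ofAut (OrderIso.refl T)).isForest_preimage hs (by simp [ofAut]) ht

/-- The setoid of the equivalence of honest almost automorphisms. -/
instance setoid (T : RootedTree.{u}) [T.IsLocallyFinite] : Setoid (HonestAAut T) where
  r := Equivalent
  iseqv := by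
    refine ⟨fun φ => ?_, ?_, ?_⟩
    · exact equivalent_iff.2 ⟨_, φ.source_eq, by simp, fun _ _ => rfl⟩
    · rintro φ ψ ⟨S, h1, h2⟩
      exact ⟨S, by rwa [inter_comm], h2.symm⟩
    · intro φ ψ χ h1 h2
      rw [equivalent_iff] at *
      obtain ⟨s, hs, h1, h1'⟩ := h1
      obtain ⟨t, ht, h2, h2'⟩ := h2
      exact ⟨s ∩ t, isForest_inter hs ht, fun x hx => ⟨(h1 hx.1).1, (h2 hx.2).2⟩,
        fun x hx => (h1' hx.1).trans (h2' hx.2)⟩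

theorem comp_equivalent [T.IsLocallyFinite] {φ φ' ψ ψ' : HonestAAut T} (h : φ ≈ φ') (k : ψ ≈ ψ') :
    φ.comp ψ ≈ φ'.comp ψ' := by
  obtain ⟨s, hs, h1, h1'⟩ := equivalent_iff.1 h
  obtain ⟨t, ht, h2, h2'⟩ := equivalent_iff.1 k
  refine equivalent_iff.2 ⟨_, ψ.isForest_preimage ht (fun x hx => (h2 hx).1) hs, ?_, ?_⟩
  · rintro x ⟨hx, hx'⟩
    refine ⟨⟨(h2 hx).1, (h1 hx').1⟩, ⟨(h2 hx).2, ?_⟩⟩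
    change ψ'.toPartialEquiv x ∈ φ'.source
    rw [← h2' hx]
    exact (h1 hx').2
  · rintro x ⟨hx, hx'⟩
    change φ.toPartialEquiv (ψ.toPartialEquiv x) = φ'.toPartialEquiv (ψ'.toPartialEquiv x)
    rw [← h2' hx]
    exact h1' hx'

theorem symm_equivalent [T.IsLocallyFinite] {φ φ' : HonestAAut T} (h : φ ≈ φ') :
    φ.symm ≈ φ'.symm := by
  obtain ⟨s, hs, h1, h1'⟩ := equivalent_iff.1 h
  have key : ∀ x ∈ φ.target, φ.toPartialEquiv.symm x ∈ s →
      x ∈ φ'.target ∧ φ.toPartialEquiv.symm x = φ'.toPartialEquiv.symm x := by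
    intro x hx hx'
    have e := h1' hx'
    rw [φ.right_inv hx] at e
    have h3 := φ'.map_source (h1 hx').2
    have h4 := φ'.left_inv (h1 hx').2
    rw [← e] at h3 h4
    exact ⟨h3, h4.symm⟩
  refine equivalent_iff.2 ⟨_, φ.symm.isForest_preimage φ.target_eq subset_rfl hs, ?_, ?_⟩
  · rintro x ⟨hx, hx'⟩
    exact ⟨hx, (key x hx hx').1⟩
  · rintro x ⟨hx, hx'⟩
    exact (key x hx hx').2

end HonestAAut

end Basic

/-- The almost automorphisms of a locally finite rooted tree: equivalence classes of honest almost
automorphisms. -/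
def AAut (T : RootedTree.{u}) [T.IsLocallyFinite] : Type u := Quotient (HonestAAut.setoid T)

namespace AAut

variable {T : RootedTree.{u}} [T.IsLocallyFinite]

/-- The almost automorphism represented by an honest almost automorphism. -/
def mk (φ : HonestAAut T) : AAut T := Quotient.mk _ φ

theorem mk_eq_mk {φ ψ : HonestAAut T} : mk φ = mk ψ ↔ HonestAAut.Equivalent φ ψ :=
  Quotient.eq (r := HonestAAut.setoid T)

theorem exists_rep (g : AAut T) : ∃ φ, mk φ = g := Quotient.exists_rep g

instance : Mul (AAut T) :=
  ⟨Quotient.map₂ HonestAAut.comp fun _ _ h _ _ k => HonestAAut.comp_equivalent h k⟩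

instance : One (AAut T) := ⟨mk (HonestAAut.ofAut (OrderIso.refl T))⟩

instance : Inv (AAut T) := ⟨Quotient.map HonestAAut.symm fun _ _ h => HonestAAut.symm_equivalent h⟩

theorem mk_mul (φ ψ : HonestAAut T) : mk φ * mk ψ = mk (φ.comp ψ) := rfl

theorem mk_inv (φ : HonestAAut T) : (mk φ)⁻¹ = mk φ.symm := rfl

theorem one_def : (1 : AAut T) = mk (HonestAAut.ofAut (OrderIso.refl T)) := rfl

/-- The product is the composition of representatives with matching image and domain. -/
instance : Group (AAut T) :=
  Group.ofLeftAxioms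
    (by
      intro a b c
      obtain ⟨φ, rfl⟩ := exists_rep a
      obtain ⟨ψ, rfl⟩ := exists_rep b
      obtain ⟨χ, rfl⟩ := exists_rep c
      rw [mk_mul, mk_mul, mk_mul, mk_mul, mk_eq_mk, HonestAAut.equivalent_iff]
      refine ⟨_, ((φ.comp ψ).comp χ).source_eq, ?_, fun x _ => rfl⟩
      rintro x hx
      exact ⟨hx, ⟨hx.1, hx.2.1⟩, hx.2.2⟩)
    (by
      intro a
      obtain ⟨φ, rfl⟩ := exists_rep a
      rw [one_def, mk_mul, mk_eq_mk, HonestAAut.equivalent_iff]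
      refine ⟨_, φ.source_eq, ?_, fun x _ => rfl⟩
      rintro x hx
      exact ⟨⟨hx, trivial⟩, hx⟩)
    (by
      intro a
      obtain ⟨φ, rfl⟩ := exists_rep a
      rw [mk_inv, one_def, mk_mul, mk_eq_mk, HonestAAut.equivalent_iff]
      refine ⟨_, φ.source_eq, ?_, fun x hx => φ.left_inv hx⟩
      rintro x hx
      exact ⟨⟨hx, φ.map_source hx⟩, trivial⟩)

/-- The almost automorphism given by an automorphism of the tree. -/
def ofAut : (T ≃o T) →* AAut T where
  toFun α := mk (HonestAAut.ofAut α)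
  map_one' := rfl
  map_mul' α β := by
    rw [mk_mul, mk_eq_mk, HonestAAut.equivalent_iff]
    exact ⟨_, (HonestAAut.ofAut (α * β)).source_eq,
      fun x _ => ⟨trivial, trivial, trivial⟩, fun x _ => rfl⟩

end AAut

/-- A colouring structure on a rooted tree `T`, with set of labels `L` and with colours in `K`.
The edge from a vertex to its child `y` is represented by `y`. The label of the root and the colours
of (the edges to) the root and its children are never used. -/
structure ColouringStructure (T : RootedTree.{u}) (L : Type v) (K : Type w) where
  /-- the labelling of the vertices different from the root -/
  label : T → L
  /-- any two vertices with the same label have label-preservingly equivalent sets of children -/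
  label_children : ∀ x y : T, x ≠ ⊥ → y ≠ ⊥ → label x = label y →
    ∃ α : T.children x ≃ T.children y, ∀ z, label (α z : T) = label (z : T)
  /-- the vertices with a given label are not contained in a proper subtree with the same root -/
  label_spanning : ∀ (l : L) (S : Set T), IsLowerSet S → ⊥ ∈ S →
    (∀ x : T, x ≠ ⊥ → label x = l → x ∈ S) → S = Set.univ
  /-- the sets of colours -/
  D : L → L → Set K
  D_finite : ∀ l l', (D l l').Finite
  D_disjoint : ∀ l l' m m', (l, l') ≠ (m, m') → Disjoint (D l l') (D m m')
  /-- the legal child colouring of the edges that do not start at the root -/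
  ccol : T → K
  /-- at each vertex `x` that is not the root, the edges to the children with label `l'` are coloured
  bijectively by `D (label x) l'`; so the latter has the right cardinality -/
  ccol_bijOn : ∀ x : T, x ≠ ⊥ → ∀ l',
    Set.BijOn ccol {y | y ∈ T.children x ∧ label y = l'} (D (label x) l')

namespace ColouringStructure

variable {T : RootedTree.{u}} {L : Type v} {K : Type w}

/-- The set `D_l` of all colours of edges that start at a vertex with label `l`. -/
def colours (𝒞 : ColouringStructure T L K) (l : L) : Set K := ⋃ l', 𝒞.D l l'

theorem ccol_mem (𝒞 : ColouringStructure T L K) {x y : T} (hx : x ≠ ⊥) (h : x ⋖ y) :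
    𝒞.ccol y ∈ 𝒞.colours (𝒞.label x) :=
  mem_iUnion.2 ⟨𝒞.label y, (𝒞.ccol_bijOn x hx _).mapsTo ⟨h, rfl⟩⟩

/-- `f` preserves the colours of the edges of the forest with vertex set `s` that do not start at
the root (here `f` has to map non-root vertices to non-root vertices and vice versa). -/
def ChildColourPreservingOn (𝒞 : ColouringStructure T L K) (f : T → T) (s : Set T) : Prop :=
  ∀ x ∈ s, (f x = ⊥ ↔ x = ⊥) ∧ (x ≠ ⊥ → ∀ y, x ⋖ y → 𝒞.ccol (f y) = 𝒞.ccol y)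

end ColouringStructure

/-- A patterning: a colouring structure together with a family of permutation groups `F_l` of the
sets `D_l`, which preserve each of the parts `D_{l,l'}` of `D_l`. -/
structure Patterning {T : RootedTree.{u}} {L : Type v} {K : Type w}
    (𝒞 : ColouringStructure T L K) where
  F : ∀ l, Subgroup (Equiv.Perm (𝒞.colours l))
  preserves : ∀ l, ∀ σ ∈ F l, ∀ l', ∀ d : 𝒞.colours l, (d : K) ∈ 𝒞.D l l' → (σ d : K) ∈ 𝒞.D l l'

namespace Patterning

variable {T : RootedTree.{u}} {L : Type v} {K : Type w} {𝒞 : ColouringStructure T L K}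

/-- The local permutation of `f` at `x`, which maps `ccol y` to `ccol (f y)` for each child `y`
of `x`, is an element of `F_l`, where `l` is the label of `x`. -/
def LocalPermMem (P : Patterning 𝒞) (f : T → T) (x : T) : Prop :=
  ∃ σ ∈ P.F (𝒞.label x), ∀ y, x ⋖ y → ∀ d : 𝒞.colours (𝒞.label x), (d : K) = 𝒞.ccol y →
    𝒞.ccol (f y) = σ d

/-- `f` preserves the labels, and all its local permutations belong to the pattern, at the non-root
vertices of the forest with vertex set `s` (here `f` has to map non-root vertices to non-root
vertices and vice versa). -/
def PatterningOn (P : Patterning 𝒞) (f : T → T) (s : Set T) : Prop :=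
  ∀ x ∈ s, (f x = ⊥ ↔ x = ⊥) ∧
    (x ≠ ⊥ → 𝒞.label (f x) = 𝒞.label x ∧ P.LocalPermMem f x)

end Patterning

section Lemmas

variable {T : RootedTree.{u}} {L : Type v} {K : Type w} {𝒞 : ColouringStructure T L K}

theorem HonestAAut.covBy [T.IsLocallyFinite] (φ : HonestAAut T) {x y : T} (hx : x ∈ φ.source)
    (h : x ⋖ y) : φ.toPartialEquiv x ⋖ φ.toPartialEquiv y := by
  have hy := φ.isUpperSet_source h.le hx
  have lt_iff : ∀ a ∈ φ.source, ∀ b ∈ φ.source,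
      φ.toPartialEquiv a < φ.toPartialEquiv b ↔ a < b := by
    intro a ha b hb
    rw [lt_iff_le_not_ge, lt_iff_le_not_ge]
    exact and_congr (φ.le_iff a ha b hb) (not_congr (φ.le_iff b hb a ha))
  refine ⟨(lt_iff x hx y hy).2 h.lt, fun c hc hc' => ?_⟩
  have hct : c ∈ φ.target := φ.isUpperSet_target hc.le (φ.map_source hx)
  rw [← φ.right_inv hct, lt_iff _ hx _ (φ.map_target hct)] at hc
  rw [← φ.right_inv hct, lt_iff _ (φ.map_target hct) _ hy] at hc'
  exact h.2 hc hc'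

theorem ColouringStructure.ChildColourPreservingOn.comp [T.IsLocallyFinite] {φ ψ : HonestAAut T}
    (hφ : 𝒞.ChildColourPreservingOn φ.toPartialEquiv φ.source)
    (hψ : 𝒞.ChildColourPreservingOn ψ.toPartialEquiv ψ.source) :
    𝒞.ChildColourPreservingOn (φ.comp ψ).toPartialEquiv (φ.comp ψ).source := by
  rintro x ⟨hx, hx'⟩
  refine ⟨(hφ _ hx').1.trans (hψ _ hx).1, fun h0 y hy => ?_⟩
  rw [← (hψ x hx).2 h0 y hy]
  exact (hφ _ hx').2 (fun h => h0 ((hψ _ hx).1.1 h)) _ (ψ.covBy hx hy)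

theorem ColouringStructure.ChildColourPreservingOn.symm [T.IsLocallyFinite] {φ : HonestAAut T}
    (hφ : 𝒞.ChildColourPreservingOn φ.toPartialEquiv φ.source) :
    𝒞.ChildColourPreservingOn φ.symm.toPartialEquiv φ.symm.source := by
  intro x hx
  have hs : φ.toPartialEquiv.symm x ∈ φ.source := φ.map_target hx
  have h := hφ _ hs
  rw [φ.right_inv hx] at h
  refine ⟨h.1.symm, fun h0 y hy => ?_⟩
  have hyt : y ∈ φ.target := φ.isUpperSet_target hy.le hx
  have := h.2 (fun h' => h0 (h.1.2 h')) _ (φ.symm.covBy hx hy)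
  change 𝒞.ccol (φ.toPartialEquiv (φ.toPartialEquiv.symm y)) = _ at this
  rw [φ.right_inv hyt] at this
  exact this.symm

theorem Patterning.PatterningOn.comp [T.IsLocallyFinite] {P : Patterning 𝒞} {φ ψ : HonestAAut T}
    (hφ : P.PatterningOn φ.toPartialEquiv φ.source)
    (hψ : P.PatterningOn ψ.toPartialEquiv ψ.source) :
    P.PatterningOn (φ.comp ψ).toPartialEquiv (φ.comp ψ).source := by
  rintro x ⟨hx, hx'⟩
  refine ⟨(hφ _ hx').1.trans (hψ _ hx).1, fun h0 => ?_⟩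
  have h1 := (hψ x hx).2 h0
  have h2 := (hφ _ hx').2 (fun h => h0 ((hψ _ hx).1.1 h))
  refine ⟨h2.1.trans h1.1, ?_⟩
  obtain ⟨l1, σ, hσ, H⟩ := h1
  obtain ⟨l2, h2⟩ := h2
  change 𝒞.label (ψ.toPartialEquiv x) = 𝒞.label x at l1
  unfold Patterning.LocalPermMem at h2
  change ∃ σ ∈ P.F (𝒞.label (ψ.toPartialEquiv x)), ∀ y, ψ.toPartialEquiv x ⋖ y →
    ∀ d : 𝒞.colours (𝒞.label (ψ.toPartialEquiv x)), (d : K) = 𝒞.ccol y →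
      𝒞.ccol (φ.toPartialEquiv y) = σ d at h2
  rw [l1] at h2
  obtain ⟨τ, hτ, H'⟩ := h2
  refine ⟨τ * σ, mul_mem hτ hσ, fun y hy d hd => ?_⟩
  exact H' _ (ψ.covBy hx hy) (σ d) (H y hy d hd).symm

theorem Patterning.PatterningOn.symm [T.IsLocallyFinite] {P : Patterning 𝒞} {φ : HonestAAut T}
    (hφ : P.PatterningOn φ.toPartialEquiv φ.source) :
    P.PatterningOn φ.symm.toPartialEquiv φ.symm.source := by
  intro x hx
  have hs : φ.toPartialEquiv.symm x ∈ φ.source := φ.map_target hx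
  have h := hφ _ hs
  rw [φ.right_inv hx] at h
  refine ⟨h.1.symm, fun h0 => ?_⟩
  have h0' : φ.toPartialEquiv.symm x ≠ ⊥ := fun h' => h0 (h.1.2 h')
  obtain ⟨l, σ, hσ, H⟩ := h.2 h0'
  refine ⟨l.symm, ?_⟩
  unfold Patterning.LocalPermMem
  rw [l]
  refine ⟨σ⁻¹, inv_mem hσ, fun y hy d hd => ?_⟩
  have hc : φ.toPartialEquiv.symm x ⋖ φ.toPartialEquiv.symm y := φ.symm.covBy hx hy
  have := H _ hc ⟨_, 𝒞.ccol_mem h0' hc⟩ rfl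
  rw [φ.right_inv (φ.isUpperSet_target hy.le hx), ← hd] at this
  rw [Subtype.ext this]
  simp
  rfl

theorem Patterning.patterningOn_id (P : Patterning 𝒞) (s : Set T) : P.PatterningOn id s :=
  fun _ _ => ⟨Iff.rfl, fun _ => ⟨rfl, 1, one_mem _, fun _ _ _ hd => hd.symm⟩⟩

end Lemmas

section Groups

variable {T : RootedTree.{u}} [T.IsLocallyFinite] {L : Type v} {K : Type w}

/-- The group `V_𝒞` of the almost automorphisms that have a child colour preserving
representative. -/
def ColouringStructure.V (𝒞 : ColouringStructure T L K) : Subgroup (AAut T) where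
  carrier := {g | ∃ φ : HonestAAut T, AAut.mk φ = g ∧
    𝒞.ChildColourPreservingOn φ.toPartialEquiv φ.source}
  mul_mem' := by
    rintro _ _ ⟨φ, rfl, hφ⟩ ⟨ψ, rfl, hψ⟩
    exact ⟨_, rfl, hφ.comp hψ⟩
  one_mem' := ⟨_, rfl, fun _ _ => ⟨Iff.rfl, fun _ _ _ => rfl⟩⟩
  inv_mem' := by
    rintro _ ⟨φ, rfl, hφ⟩
    exact ⟨_, rfl, hφ.symm⟩

namespace Patterning

variable {𝒞 : ColouringStructure T L K}

/-- The group `AAut_𝒫(T)` of the almost automorphisms that have a patterning representative. -/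
def AAutP (P : Patterning 𝒞) : Subgroup (AAut T) where
  carrier := {g | ∃ φ : HonestAAut T, AAut.mk φ = g ∧ P.PatterningOn φ.toPartialEquiv φ.source}
  mul_mem' := by
    rintro _ _ ⟨φ, rfl, hφ⟩ ⟨ψ, rfl, hψ⟩
    exact ⟨_, rfl, hφ.comp hψ⟩
  one_mem' := ⟨_, rfl, P.patterningOn_id _⟩
  inv_mem' := by
    rintro _ ⟨φ, rfl, hφ⟩
    exact ⟨_, rfl, hφ.symm⟩

/-- The group `Aut_𝒫(T)` of the patterning automorphisms of the rooted tree `T`. -/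
def AutP (P : Patterning 𝒞) : Subgroup (T ≃o T) where
  carrier := {α | P.PatterningOn α Set.univ}
  mul_mem' {α β} ha hb x _ :=
    PatterningOn.comp (φ := .ofAut α) (ψ := .ofAut β) ha hb x ⟨trivial, trivial⟩
  one_mem' := P.patterningOn_id _
  inv_mem' {α} ha := PatterningOn.symm (φ := .ofAut α) ha

/-- If some non-root vertex has two children, then no vertex is childless. -/
theorem _root_.RootedTree.ColouringStructure.exists_child (𝒞 : ColouringStructure T L K)
    (h : ∃ x : T, x ≠ ⊥ ∧ (T.children x).Nontrivial) (x : T) : (T.children x).Nonempty := by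
  obtain ⟨a, ha, hn⟩ := h
  by_contra hx
  have hup : IsLowerSet ({x}ᶜ : Set T) := by
    rintro p q hqp hp rfl
    obtain ⟨z, hz, _⟩ := exists_child_of_lt (lt_of_le_of_ne hqp (Ne.symm hp))
    exact hx ⟨z, hz⟩
  by_cases hb : x = ⊥
  · subst hb
    obtain ⟨z, hz, _⟩ := exists_child_of_lt (bot_lt_iff_ne_bot.2 ha)
    exact hx ⟨z, hz⟩
  · have hex : ∃ y : T, y ≠ ⊥ ∧ 𝒞.label y = 𝒞.label a ∧ y = x := by
      by_contra hne
      push Not at hne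
      have := 𝒞.label_spanning (𝒞.label a) {x}ᶜ hup (Ne.symm hb) hne
      have h2 : x ∈ ({x}ᶜ : Set T) := this ▸ Set.mem_univ x
      exact h2 rfl
    obtain ⟨y, hy, hl, rfl⟩ := hex
    obtain ⟨α, _⟩ := 𝒞.label_children a y ha hy hl.symm
    obtain ⟨z, hz⟩ := hn.nonempty
    exact hx ⟨_, (α ⟨z, hz⟩).2⟩

/-- `V_𝒞` is contained in `AAut_𝒫(T)`. -/
theorem V_le_AAutP (P : Patterning 𝒞) (h : ∃ x : T, x ≠ ⊥ ∧ (T.children x).Nontrivial) :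
    𝒞.V ≤ P.AAutP := by
  rintro _ ⟨φ, rfl, hφ⟩
  refine ⟨φ, rfl, fun x hx => ⟨(hφ x hx).1, fun h0 => ?_⟩⟩
  refine ⟨?_, 1, one_mem _, fun y hy d hd => ?_⟩
  · obtain ⟨y, hy⟩ := 𝒞.exists_child h x
    have e := (hφ x hx).2 h0 y hy
    have h1 := (𝒞.ccol_bijOn x h0 _).mapsTo ⟨hy, rfl⟩
    have h2 := (𝒞.ccol_bijOn _ (fun h' => h0 ((hφ x hx).1.1 h')) _).mapsTo ⟨φ.covBy hx hy, rfl⟩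
    rw [e] at h2
    by_contra hne
    refine Set.disjoint_left.1 (𝒞.D_disjoint _ _ _ _ ?_) h2 h1
    intro h'
    exact hne (Prod.mk.inj h').1
  · rw [(hφ x hx).2 h0 y hy]
    exact hd.symm

/-- The pointwise stabilizer in `Aut_𝒫(T)` of a set of vertices, as a subset of `AAut_𝒫(T)`. -/
def fixP (P : Patterning 𝒞) (S : Set T) : Set P.AAutP :=
  {g | ∃ α ∈ P.AutP, (∀ x ∈ S, α x = x) ∧ (g : AAut T) = AAut.ofAut α}

/-- The conjugate of an automorphism by an honest almost automorphism, extended by the identity. -/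
noncomputable def glue (φ : HonestAAut T) (α : T ≃o T) : T → T := by
  classical exact fun x =>
    if x ∈ φ.target then φ.toPartialEquiv (α (φ.toPartialEquiv.symm x)) else x

theorem glue_of_mem {φ : HonestAAut T} {α : T ≃o T} {x : T} (h : x ∈ φ.target) :
    glue φ α x = φ.toPartialEquiv (α (φ.toPartialEquiv.symm x)) := by
  simp [glue, h]

theorem glue_of_notMem {φ : HonestAAut T} {α : T ≃o T} {x : T} (h : x ∉ φ.target) :
    glue φ α x = x := by
  simp [glue, h]

/-- The minimal vertices of a forest. -/
def minimals (s : Set T) : Set T := {x | x ∈ s ∧ ∀ y, y ⋖ x → y ∉ s}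

theorem symm_mem_minimals {φ : HonestAAut T} {x : T} (h : x ∈ minimals φ.target) :
    φ.toPartialEquiv.symm x ∈ minimals φ.source := by
  refine ⟨φ.map_target h.1, fun y hy hys => ?_⟩
  have := φ.covBy hys hy
  rw [φ.right_inv h.1] at this
  exact h.2 _ this (φ.map_source hys)

theorem map_mem_source {φ : HonestAAut T} {α : T ≃o T} (h : ∀ x ∈ minimals φ.source, α x = x)
    {x : T} (hx : x ∈ φ.source) : α x ∈ φ.source := by
  obtain ⟨z, hz, hzx, hm⟩ := exists_minimal_le hx
  have := α.le_iff_le.2 hzx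
  rw [h z ⟨hz, hm⟩] at this
  exact φ.isUpperSet_source this hz

theorem glue_minimal {φ : HonestAAut T} {α : T ≃o T} (h : ∀ x ∈ minimals φ.source, α x = x)
    {x : T} (hx : x ∈ minimals φ.target) : glue φ α x = x := by
  rw [glue_of_mem hx.1, h _ (symm_mem_minimals hx), φ.right_inv hx.1]

theorem glue_mem_target {φ : HonestAAut T} {α : T ≃o T} (h : ∀ x ∈ minimals φ.source, α x = x)
    {x : T} (hx : x ∈ φ.target) : glue φ α x ∈ φ.target := by
  rw [glue_of_mem hx]
  exact φ.map_source (map_mem_source h (φ.map_target hx))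

theorem glue_monotone {φ : HonestAAut T} {α : T ≃o T} (h : ∀ x ∈ minimals φ.source, α x = x) :
    Monotone (glue φ α) := by
  have hmem : ∀ x ∈ φ.target, ∀ y ∈ φ.target, x ≤ y → glue φ α x ≤ glue φ α y := by
    intro x hx y hy hxy
    rw [glue_of_mem hx, glue_of_mem hy]
    refine (φ.le_iff _ (map_mem_source h (φ.map_target hx)) _
      (map_mem_source h (φ.map_target hy))).2 (α.le_iff_le.2 ?_)
    exact (φ.symm.le_iff x hx y hy).2 hxy
  intro x y hxy
  by_cases hx : x ∈ φ.target
  · exact hmem x hx y (φ.isUpperSet_target hxy hx) hxy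
  · rw [glue_of_notMem hx]
    by_cases hy : y ∈ φ.target
    · obtain ⟨z, hz, hzy, hm⟩ := exists_minimal_le hy
      have hxz : x ≤ z := by
        rcases le_total_of_directed hxy hzy with h' | h'
        · exact absurd (φ.isUpperSet_target h' hz) hx
        · exact h'
      have := hmem z hz y hy hzy
      rw [glue_minimal h ⟨hz, hm⟩] at this
      exact hxz.trans this
    · rwa [glue_of_notMem hy]

theorem glue_glue {φ : HonestAAut T} {α β : T ≃o T} (h : ∀ x ∈ minimals φ.source, α x = x)
    (hβ : ∀ x, β (α x) = x) (x : T) : glue φ β (glue φ α x) = x := by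
  by_cases hx : x ∈ φ.target
  · rw [glue_of_mem (glue_mem_target h hx), glue_of_mem hx,
      φ.left_inv (map_mem_source h (φ.map_target hx)), hβ, φ.right_inv hx]
  · rw [glue_of_notMem (x := x) hx, glue_of_notMem hx]

/-- `glue` as an automorphism of the tree. -/
noncomputable def glueIso (φ : HonestAAut T) (α : T ≃o T) (h : ∀ x ∈ minimals φ.source, α x = x) :
    T ≃o T :=
  have h' : ∀ x ∈ minimals φ.source, α.symm x = x := fun x hx => by
    rw [OrderIso.symm_apply_eq, h x hx]
  Equiv.toOrderIso ⟨glue φ α, glue φ α.symm, glue_glue h (by simp), glue_glue h' (by simp)⟩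
    (glue_monotone h) (glue_monotone h')

theorem glueIso_mem (P : Patterning 𝒞) {φ : HonestAAut T}
    (hφ : P.PatterningOn φ.toPartialEquiv φ.source) {α : T ≃o T} (hα : α ∈ P.AutP)
    (h : ∀ x ∈ minimals φ.source, α x = x) : glueIso φ α h ∈ P.AutP := by
  intro x _
  refine ⟨by simp, fun h0 => ?_⟩
  change 𝒞.label (glue φ α x) = _ ∧ P.LocalPermMem (glue φ α) x
  by_cases hx : x ∈ φ.target
  · have hα' : P.PatterningOn (HonestAAut.ofAut α).toPartialEquiv (HonestAAut.ofAut α).source := hα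
    have := ((hφ.comp hα').comp hφ.symm x
      ⟨hx, trivial, map_mem_source h (φ.map_target hx)⟩).2 h0
    obtain ⟨h1, σ, hσ, H⟩ := this
    rw [glue_of_mem hx]
    refine ⟨h1, σ, hσ, fun y hy d hd => ?_⟩
    rw [glue_of_mem (φ.isUpperSet_target hy.le hx)]
    exact H y hy d hd
  · rw [glue_of_notMem hx]
    refine ⟨rfl, 1, one_mem _, fun y hy d hd => ?_⟩
    have : glue φ α y = y := by
      by_cases hyt : y ∈ φ.target
      · refine glue_minimal h ⟨hyt, fun z hz => ?_⟩
        rwa [← hz.pred_eq, hy.pred_eq]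
      · exact glue_of_notMem hyt
    rw [this]
    exact hd.symm

theorem ofAut_glueIso {φ : HonestAAut T} {α : T ≃o T} (h : ∀ x ∈ minimals φ.source, α x = x) :
    AAut.ofAut (glueIso φ α h) = AAut.mk φ * AAut.ofAut α * (AAut.mk φ)⁻¹ := by
  change AAut.mk _ = AAut.mk φ * AAut.mk (.ofAut α) * (AAut.mk φ)⁻¹
  rw [AAut.mk_inv, AAut.mk_mul, AAut.mk_mul, AAut.mk_eq_mk, HonestAAut.equivalent_iff]
  refine ⟨φ.target, φ.target_eq, fun x hx => ?_, fun x hx => glue_of_mem hx⟩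
  exact ⟨trivial, hx, trivial, map_mem_source h (φ.map_target hx)⟩

theorem finite_minimals (φ : HonestAAut T) : (minimals φ.source).Finite := by
  have hf := (isForest_iff.1 φ.source_eq).2.1
  refine ((finite_singleton (⊥ : T)).union
    (hf.biUnion fun x _ => IsLocallyFinite.finite_children x)).subset fun x hx => ?_
  by_cases h0 : x = ⊥
  · exact Or.inl h0
  · have hc := Order.pred_covBy_of_not_isMin (a := x) (by simpa using h0)
    exact Or.inr (mem_biUnion (show Order.pred x ∈ φ.sourceᶜ from hx.2 _ hc) hc)

/-- The stabilizers in `Aut_𝒫(T)` of the finite sets of vertices form a neighbourhood basis of the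
identity for a group topology on `AAut_𝒫(T)`. -/
@[reducible]
def basis (P : Patterning 𝒞) : GroupFilterBasis P.AAutP where
  sets := {U | ∃ S : Set T, S.Finite ∧ U = P.fixP S}
  nonempty := ⟨_, ∅, finite_empty, rfl⟩
  inter_sets := by
    rintro _ _ ⟨S, hS, rfl⟩ ⟨S', hS', rfl⟩
    refine ⟨_, ⟨S ∪ S', hS.union hS', rfl⟩, ?_⟩
    rintro g ⟨α, hα, h, hg⟩
    exact ⟨⟨α, hα, fun x hx => h x (Or.inl hx), hg⟩, ⟨α, hα, fun x hx => h x (Or.inr hx), hg⟩⟩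
  one' := by
    rintro _ ⟨S, hS, rfl⟩
    exact ⟨1, one_mem _, fun _ _ => rfl, by simp⟩
  mul' := by
    rintro _ ⟨S, hS, rfl⟩
    refine ⟨_, ⟨S, hS, rfl⟩, ?_⟩
    rintro _ ⟨g, ⟨α, hα, h, hg⟩, g', ⟨β, hβ, h', hg'⟩, rfl⟩
    refine ⟨α * β, mul_mem hα hβ, fun x hx => ?_, by simp [hg, hg']⟩
    change α (β x) = x
    rw [h' x hx, h x hx]
  inv' := by
    rintro _ ⟨S, hS, rfl⟩
    refine ⟨_, ⟨S, hS, rfl⟩, ?_⟩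
    rintro g ⟨α, hα, h, hg⟩
    refine ⟨α⁻¹, inv_mem hα, fun x hx => ?_, by simp [hg]⟩
    change α.symm x = x
    rw [OrderIso.symm_apply_eq, h x hx]
  conj' := by
    rintro ⟨_, φ, rfl, hφ⟩ _ ⟨S, hS, rfl⟩
    refine ⟨_, ⟨minimals φ.source ∪ φ.toPartialEquiv.symm '' S,
      (finite_minimals φ).union (hS.image _), rfl⟩, ?_⟩
    rintro g ⟨α, hα, h, hg⟩
    have hm : ∀ x ∈ minimals φ.source, α x = x := fun x hx => h x (Or.inl hx)
    refine ⟨glueIso φ α hm, P.glueIso_mem hφ hα hm, fun x hx => ?_, ?_⟩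
    · change glue φ α x = x
      by_cases hxt : x ∈ φ.target
      · rw [glue_of_mem hxt, h _ (Or.inr ⟨x, hx, rfl⟩), φ.right_inv hxt]
      · exact glue_of_notMem hxt
    · rw [ofAut_glueIso, ← hg]
      rfl

/-- The group topology on `AAut_𝒫(T)` for which `Aut_𝒫(T)`, with the topology of pointwise
convergence on the vertices, is an open subgroup. -/
instance (P : Patterning 𝒞) : TopologicalSpace P.AAutP := P.basis.topology

instance (P : Patterning 𝒞) : IsTopologicalGroup P.AAutP := P.basis.isTopologicalGroup

end Patterning

end Groups

end RootedTree

/-- A topological group is topologically simple if it is nontrivial and its only closed normal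
subgroups are the trivial one and the whole group. -/
def IsTopologicallySimple (G : Type u) [Group G] [TopologicalSpace G] : Prop :=
  Nontrivial G ∧ ∀ N : Subgroup G, N.Normal → IsClosed (N : Set G) → N = ⊥ ∨ N = ⊤

/-! Almost automorphisms are handled as germs of maps `T → T` along the cofinite filter: no vertex
is childless, so a germ determines the almost automorphism (`AAut.ext_rep`). In these terms one can
say that an element is supported in a set of vertices, or maps one set into another, up to finitely
many vertices; elements with disjoint supports commute, and conjugation moves supports. The cylinder of a
vertex `x` is `Ici x`, and two vertices are incomparable exactly when their cylinders are disjoint.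

*The two closures agree* because `V_𝒞` is dense (`Patterning.dense_V`): a patterning representative
`φ`, defined on a small forest, agrees on the minimal vertices of this forest with the
colour-preserving map between the same forests, and the two differ by a patterning automorphism of
the tree that fixes everything outside of the forest. By continuity the commutators of a dense
subgroup are dense among all commutators.

*Topological simplicity.* Every label occurs above every non-root vertex, and there is branching
above every vertex. Hence `V_𝒞` contains many involutions exchanging two cylinders (`exists_swap`),
and products of them move finitely many disjoint cylinders, in particular the complement of any
cylinder, into any other cylinder; this can even be done by an element of the commutator subgroup
`D(V_𝒞)` (`exists_commutator_move`, `exists_commutator_move_compl`).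

Let `M` be the subgroup generated by the commutators of elements of `V_𝒞` that fix a common cylinder
(`localCommutator`). It is normalized by `V_𝒞`. Every element of `V_𝒞` is a product of two elements
that each fix a cylinder (`exists_eq_mul_of_mem_V`), and modulo `M` the support of such an element
can be moved into an arbitrarily small cylinder, so that any two of them commute modulo `M`
(`commutator_mem_of_mem_fixCylinder`). So `M` contains `D(V_𝒞)`.

Finally let `N` be a subgroup normalized by `D(V_𝒞)` that contains some `g ≠ 1`. Then `g` moves some
cylinder off itself (`AAut.exists_disjoint_of_ne_one`), and the commutator identity
`⁅a, b⁆ = ⁅⁅a, g⁆, b⁆` for `a`, `b` supported in this cylinder shows that `N` contains the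
commutators of all elements of `V_𝒞` supported in some smaller cylinder. Conjugation with elements
of `D(V_𝒞)` spreads this to all generators of `M`, so `N` contains `D(V_𝒞)`
(`commutator_V_le_of_normalized`). If `N` is moreover closed, it contains the closure. -/

namespace RootedTree

open Filter

open scoped commutatorElement

/-! ### Vertices and cylinders -/

section Tree

variable {T : RootedTree.{u}}

theorem disjoint_Ici_iff {x y : T} : Disjoint (Ici x) (Ici y) ↔ ¬ x ≤ y ∧ ¬ y ≤ x := by
  rw [Set.disjoint_left]
  constructor
  · intro h
    exact ⟨fun hxy => h (mem_Ici.2 hxy) (mem_Ici.2 le_rfl),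
      fun hyx => h (mem_Ici.2 le_rfl) (mem_Ici.2 hyx)⟩
  · rintro ⟨h1, h2⟩ z hx hy
    exact (le_total_of_directed (mem_Ici.1 hx) (mem_Ici.1 hy)).elim h2 h1

theorem disjoint_Ici_mono {x x' y y' : T} (h : Disjoint (Ici x) (Ici y)) (hx : x ≤ x')
    (hy : y ≤ y') : Disjoint (Ici x') (Ici y') :=
  h.mono (Ici_subset_Ici.2 hx) (Ici_subset_Ici.2 hy)

theorem disjoint_Ici_of_covBy {x y z : T} (hy : x ⋖ y) (hz : x ⋖ z) (h : y ≠ z) :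
    Disjoint (Ici y) (Ici z) := by
  rw [disjoint_Ici_iff]
  constructor
  · intro hle
    exact hy.lt.not_ge (le_of_lt_covBy hz (lt_of_le_of_ne hle h))
  · intro hle
    exact hz.lt.not_ge (le_of_lt_covBy hy (lt_of_le_of_ne hle h.symm))

theorem ne_bot_of_disjoint_Ici {x y : T} (h : Disjoint (Ici x) (Ici y)) : x ≠ ⊥ := by
  rintro rfl
  exact (disjoint_Ici_iff.1 h).1 bot_le

theorem ne_bot_of_ne_bot_of_le {x y : T} (hx : x ≠ ⊥) (h : x ≤ y) : y ≠ ⊥ := by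
  rintro rfl
  exact hx (le_bot_iff.1 h)

theorem covBy_unique {x y z : T} (hx : x ⋖ z) (hy : y ⋖ z) : x = y := by
  rw [← hx.pred_eq, hy.pred_eq]

theorem finite_Iic (x : T) : (Iic x).Finite := by
  refine tree_induction (p := fun x => (Iic x).Finite) ?_ ?_ x
  · simp
  · intro a b hab ha
    refine (ha.insert b).subset fun z hz => ?_
    rcases (mem_Iic.1 hz).eq_or_lt with rfl | h
    · exact Or.inl rfl
    · exact Or.inr (le_of_lt_covBy hab h)

/-- The roots of the branches that leave the path from the root to `u`: up to finitely many
vertices, their cylinders partition the complement of the cylinder of `u`. -/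
def offPath (u : T) : Set T := {y | ∃ p, p < u ∧ p ⋖ y ∧ ¬ y ≤ u}

theorem finite_offPath [T.IsLocallyFinite] (u : T) : (offPath u).Finite := by
  refine ((finite_Iic u).biUnion fun p _ => IsLocallyFinite.finite_children p).subset ?_
  rintro y ⟨p, hp, hy, -⟩
  exact mem_biUnion (mem_Iic.2 hp.le) hy

theorem pairwiseDisjoint_offPath (u : T) : (offPath u).PairwiseDisjoint Ici := by
  rintro y ⟨p, hp, hpy, hy⟩ z ⟨q, hq, hqz, hz⟩ hne
  refine disjoint_Ici_iff.2 ⟨fun h => hy ?_, fun h => hz ?_⟩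
  · exact (le_of_lt_covBy hqz (lt_of_le_of_ne h hne)).trans hq.le
  · exact (le_of_lt_covBy hpy (lt_of_le_of_ne h hne.symm)).trans hp.le

theorem disjoint_of_mem_offPath {u y : T} (h : y ∈ offPath u) : Disjoint (Ici y) (Ici u) := by
  obtain ⟨p, hp, hpy, hy⟩ := h
  refine disjoint_Ici_iff.2 ⟨hy, fun huy => ?_⟩
  rcases huy.eq_or_lt with rfl | hlt
  · exact hy le_rfl
  · exact hp.not_ge (le_of_lt_covBy hpy hlt)

theorem mem_iUnion_offPath {u z : T} (h : Disjoint (Ici u) (Ici z)) :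
    ∃ y ∈ offPath u, z ∈ Ici y := by
  obtain ⟨h1, h2⟩ := disjoint_Ici_iff.1 h
  have hu : z ⊓ u < u := lt_of_le_of_ne inf_le_right fun e => h1 (inf_eq_right.1 e)
  have hz : z ⊓ u < z := lt_of_le_of_ne inf_le_left fun e => h2 (inf_eq_left.1 e)
  obtain ⟨y, hy, hyz⟩ := exists_child_of_lt hz
  exact ⟨y, ⟨_, hu, hy, fun hyu => hy.lt.not_ge (le_inf hyz hyu)⟩, hyz⟩

theorem finite_compl_forall_ge_mem {s : Set T} (hs : sᶜ.Finite) :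
    {z | ∀ y, z ≤ y → y ∈ s}ᶜ.Finite := by
  refine (hs.biUnion fun y _ => finite_Iic y).subset fun z hz => ?_
  simp only [mem_compl_iff, mem_ofPred_eq, not_forall] at hz
  obtain ⟨y, hzy, hy⟩ := hz
  exact mem_biUnion (show y ∈ sᶜ from hy) hzy

end Tree

/-! ### Almost automorphisms as germs -/

section Germs

variable {T : RootedTree.{u}} [T.IsLocallyFinite]

theorem HonestAAut.source_mem_cofinite (φ : HonestAAut T) : φ.source ∈ (cofinite : Filter T) :=
  (isForest_iff.1 φ.source_eq).2.1

theorem HonestAAut.tendsto_cofinite (φ : HonestAAut T) :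
    Tendsto φ.toPartialEquiv cofinite cofinite := by
  intro s hs
  rw [mem_cofinite] at hs
  rw [mem_map, mem_cofinite]
  refine ((isForest_iff.1 φ.source_eq).2.1.union (hs.image φ.toPartialEquiv.symm)).subset ?_
  intro z hz
  by_cases hzs : z ∈ φ.source
  · exact Or.inr ⟨_, hz, φ.left_inv hzs⟩
  · exact Or.inl hzs

theorem forest_mem_cofinite (S : CompleteSubtree T) : S.forest ∈ (cofinite : Filter T) :=
  (isForest_iff.1 ⟨S, rfl⟩).2.1

/-- If no vertex is childless, every set with finite complement contains a forest. -/
theorem exists_forest_of_mem_cofinite (hT : ∀ x : T, (T.children x).Nonempty) {s : Set T}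
    (hs : s ∈ (cofinite : Filter T)) :
    ∃ t, (∃ S : CompleteSubtree T, t = S.forest) ∧ t ⊆ s := by
  refine ⟨{z | ∀ y, z ≤ y → y ∈ s}, isForest_iff.2 ⟨?_, ?_, fun x _ => hT x⟩,
    fun z hz => hz z le_rfl⟩
  · intro a b hab ha y hy
    exact ha y (hab.trans hy)
  · exact finite_compl_forall_ge_mem hs

namespace AAut

/-- The underlying map of a chosen representative. Only its germ along the cofinite filter is
determined by the almost automorphism. -/
noncomputable def rep (g : AAut T) : T → T := (Quotient.out g).toPartialEquiv

theorem mk_out (g : AAut T) : mk (Quotient.out g) = g := Quotient.out_eq g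

theorem eventuallyEq_of_mk_eq {φ ψ : HonestAAut T} (h : mk φ = mk ψ) :
    φ.toPartialEquiv =ᶠ[cofinite] ψ.toPartialEquiv := by
  obtain ⟨S, -, hS⟩ := mk_eq_mk.1 h
  exact mem_of_superset (forest_mem_cofinite S) hS

theorem rep_mk (φ : HonestAAut T) : (mk φ).rep =ᶠ[cofinite] φ.toPartialEquiv :=
  eventuallyEq_of_mk_eq (mk_out _)

theorem tendsto_rep (g : AAut T) : Tendsto g.rep cofinite cofinite :=
  HonestAAut.tendsto_cofinite _

theorem rep_mul (g h : AAut T) : ∀ᶠ z in cofinite, (g * h).rep z = g.rep (h.rep z) := by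
  have := rep_mk ((Quotient.out g).comp (Quotient.out h))
  rw [← mk_mul, mk_out, mk_out] at this
  exact this

theorem rep_one : ∀ᶠ z in cofinite, (1 : AAut T).rep z = z := rep_mk _

theorem rep_inv_rep (g : AAut T) : ∀ᶠ z in cofinite, g⁻¹.rep (g.rep z) = z := by
  have h := rep_mul g⁻¹ g
  rw [inv_mul_cancel] at h
  filter_upwards [h, rep_one] with z h1 h2
  rw [← h1, h2]

theorem rep_rep_inv (g : AAut T) : ∀ᶠ z in cofinite, g.rep (g⁻¹.rep z) = z := by
  simpa using rep_inv_rep g⁻¹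

theorem ext_rep (hT : ∀ x : T, (T.children x).Nonempty) {g h : AAut T}
    (H : ∀ᶠ z in cofinite, g.rep z = h.rep z) : g = h := by
  rw [← mk_out g, ← mk_out h, mk_eq_mk, HonestAAut.equivalent_iff]
  obtain ⟨t, ht, hts⟩ := exists_forest_of_mem_cofinite hT
    (inter_mem (inter_mem (Quotient.out g).source_mem_cofinite
      (Quotient.out h).source_mem_cofinite) H)
  exact ⟨t, ht, fun z hz => (hts hz).1, fun z hz => (hts hz).2⟩

/-- The almost automorphisms that fix all but finitely many of the vertices outside of `A`. -/
def supportedIn (A : Set T) : Subgroup (AAut T) where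
  carrier := {g | ∀ᶠ z in cofinite, z ∉ A → g.rep z = z}
  one_mem' := by
    change ∀ᶠ z in cofinite, z ∉ A → (1 : AAut T).rep z = z
    filter_upwards [rep_one (T := T)] with z hz _ using hz
  mul_mem' {g h} hg hh := by
    change ∀ᶠ z in cofinite, z ∉ A → (g * h).rep z = z
    filter_upwards [rep_mul g h, hg, hh] with z h1 h2 h3 hz
    rw [h1, h3 hz, h2 hz]
  inv_mem' {g} hg := by
    change ∀ᶠ z in cofinite, z ∉ A → g⁻¹.rep z = z
    filter_upwards [rep_inv_rep g, hg] with z h1 h2 hz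
    conv_lhs => rw [← h2 hz]
    exact h1

theorem mem_supportedIn {A : Set T} {g : AAut T} :
    g ∈ supportedIn A ↔ ∀ᶠ z in cofinite, z ∉ A → g.rep z = z := Iff.rfl

theorem supportedIn_mono {A B : Set T} (h : A ⊆ B) : supportedIn A ≤ supportedIn B := by
  intro g hg
  filter_upwards [mem_supportedIn.1 hg] with z hz hzB using hz fun hA => hzB (h hA)

/-- `g` maps all but finitely many of the vertices in `A` into `B`. -/
def MapsTo (g : AAut T) (A B : Set T) : Prop := ∀ᶠ z in cofinite, z ∈ A → g.rep z ∈ B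

namespace MapsTo

variable {g h : AAut T} {A B C : Set T}

theorem mul (hg : g.MapsTo B C) (hh : h.MapsTo A B) : (g * h).MapsTo A C := by
  filter_upwards [rep_mul g h, hh, (tendsto_rep h).eventually hg] with z h1 h2 h3 hz
  rw [h1]
  exact h3 (h2 hz)

theorem mono {A' B' : Set T} (hg : g.MapsTo A B) (hA : A' ⊆ A) (hB : B ⊆ B') :
    g.MapsTo A' B' := by
  filter_upwards [hg] with z hz hzA using hB (hz (hA hzA))

theorem union {B' : Set T} (h1 : g.MapsTo A C) (h2 : g.MapsTo B B') :
    g.MapsTo (A ∪ B) (C ∪ B') := by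
  filter_upwards [h1, h2] with z hz hz'
  rintro (hzA | hzB)
  exacts [Or.inl (hz hzA), Or.inr (hz' hzB)]

end MapsTo

theorem mapsTo_of_disjoint {g : AAut T} {A B : Set T} (hg : g ∈ supportedIn A)
    (h : Disjoint A B) : g.MapsTo B B := by
  filter_upwards [mem_supportedIn.1 hg] with z hz hzB
  rwa [hz fun hA => Set.disjoint_left.1 h hA hzB]

theorem mapsTo_self {g : AAut T} {A : Set T} (hg : g ∈ supportedIn A) : g.MapsTo A A := by
  filter_upwards [(tendsto_rep g).eventually (mem_supportedIn.1 hg), rep_inv_rep g,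
    (tendsto_rep g).eventually (rep_inv_rep g)] with z h1 h2 h3 hz
  by_contra hA
  rw [h1 hA, h2] at h3
  exact hA (h3 ▸ hz)

theorem conj_mem_supportedIn {g a : AAut T} {A B : Set T} (hg : g.MapsTo A B)
    (ha : a ∈ supportedIn A) : g * a * g⁻¹ ∈ supportedIn B := by
  have ht := tendsto_rep g⁻¹
  filter_upwards [rep_mul (g * a) g⁻¹, ht.eventually (rep_mul g a), rep_rep_inv g,
    ht.eventually hg, ht.eventually (mem_supportedIn.1 ha)] with z h1 h2 h3 h4 h5 hz
  rw [h1, h2, h5, h3]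
  intro hA
  apply hz
  rw [← h3]
  exact h4 hA

theorem commute_of_disjoint (hT : ∀ x : T, (T.children x).Nonempty) {a b : AAut T} {A B : Set T}
    (ha : a ∈ supportedIn A) (hb : b ∈ supportedIn B) (h : Disjoint A B) : Commute a b := by
  refine ext_rep hT ?_
  filter_upwards [rep_mul a b, rep_mul b a, mapsTo_self ha, mapsTo_self hb,
    mem_supportedIn.1 ha, mem_supportedIn.1 hb, (tendsto_rep a).eventually (mem_supportedIn.1 hb),
    (tendsto_rep b).eventually (mem_supportedIn.1 ha)] with z h1 h2 h3 h4 h5 h6 h7 h8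
  rw [h1, h2]
  by_cases hzA : z ∈ A
  · rw [h6 (Set.disjoint_left.1 h hzA), h7 (Set.disjoint_left.1 h (h3 hzA))]
  · by_cases hzB : z ∈ B
    · rw [h5 hzA, h8 (Set.disjoint_right.1 h (h4 hzB))]
    · rw [h5 hzA, h6 hzB, h5 hzA]

theorem mapsTo_mk {φ : HonestAAut T} {x : T} (hx : x ∈ φ.source) :
    (mk φ).MapsTo (Ici x) (Ici (φ.toPartialEquiv x)) := by
  filter_upwards [rep_mk φ] with z hz hxz
  rw [hz]
  exact (φ.le_iff x hx z (φ.isUpperSet_source hxz hx)).2 hxz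

/-- Almost automorphisms other than the identity move some cylinder off itself: if each vertex is
comparable to its image, then all branching vertices of the domain are fixed, and hence so are all
their ancestors. -/
theorem exists_disjoint_of_ne_one
    (hT : ∀ x : T, ∃ y, x ≤ y ∧ (T.children y).Nontrivial) {φ : HonestAAut T} (h : mk φ ≠ 1) :
    ∃ x ∈ φ.source, Disjoint (Ici x) (Ici (φ.toPartialEquiv x)) := by
  by_contra hne
  push Not at hne
  have hcomp : ∀ x ∈ φ.source, x ≤ φ.toPartialEquiv x ∨ φ.toPartialEquiv x ≤ x := by
    intro x hx
    have := hne x hx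
    rw [disjoint_Ici_iff] at this
    tauto
  have hbranch : ∀ x ∈ φ.source, (T.children x).Nontrivial → φ.toPartialEquiv x = x := by
    rintro x hx ⟨y, hy, z, hz, hyz⟩
    have hys := φ.isUpperSet_source (CovBy.le hy) hx
    have hzs := φ.isUpperSet_source (CovBy.le hz) hx
    have hy' := φ.covBy hx hy
    have hz' := φ.covBy hx hz
    have hd := disjoint_Ici_iff.1
      (disjoint_Ici_of_covBy hy' hz' fun e => hyz (φ.injOn hys hzs e))
    have hd' := disjoint_Ici_iff.1 (disjoint_Ici_of_covBy hy hz hyz)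
    -- If `φ a` were a proper ancestor of `a`, it would also be one of `b`, and hence be comparable
    -- to `φ b`, which is comparable to `b`.
    have key : ∀ {a b : T}, x ⋖ a → x ⋖ b → a ≤ φ.toPartialEquiv a ∨ φ.toPartialEquiv a ≤ a →
        b ≤ φ.toPartialEquiv b ∨ φ.toPartialEquiv b ≤ b →
        ¬ φ.toPartialEquiv a ≤ φ.toPartialEquiv b → ¬ φ.toPartialEquiv b ≤ φ.toPartialEquiv a →
        a ≤ φ.toPartialEquiv a := by
      intro a b ha hb hca hcb h1 h2
      by_contra hn
      have hle := hca.resolve_left hn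
      have hax : φ.toPartialEquiv a ≤ x :=
        le_of_lt_covBy ha (lt_of_le_of_ne hle fun e => hn e.ge)
      rcases hcb with h3 | h3
      · exact h1 (hax.trans (hb.le.trans h3))
      · exact (le_total_of_directed (hax.trans hb.le) h3).elim h2 h1
    have hy2 := key hy hz (hcomp y hys) (hcomp z hzs) hd.1 hd.2
    have hz2 := key hz hy (hcomp z hzs) (hcomp y hys) hd.2 hd.1
    have e1 : y ⊓ z = x := by
      apply le_antisymm
      · exact le_of_lt_covBy hy (lt_of_le_of_ne inf_le_left fun e => hd'.1 (inf_eq_left.1 e))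
      · exact le_inf (CovBy.le hy) (CovBy.le hz)
    apply le_antisymm
    · by_contra hle
      rcases hcomp x hx with h3 | h3
      · -- If `x < φ x`, then `φ x` would be a descendant of both `y` and `z`.
        have hlt := lt_of_le_not_ge h3 hle
        have hyx : ¬ y ≤ φ.toPartialEquiv x ∨ ¬ z ≤ φ.toPartialEquiv x := by
          by_contra hcon
          push Not at hcon
          exact (le_total_of_directed hcon.1 hcon.2).elim hd'.2 hd'.1
        have aux : ∀ {a : T}, x ⋖ a → a ≤ φ.toPartialEquiv a →
            φ.toPartialEquiv x ⋖ φ.toPartialEquiv a → a ≤ φ.toPartialEquiv x := by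
          intro a ha haa hcov
          rcases haa.eq_or_lt with e | hlt'
          · rw [← e] at hcov
            exact absurd hlt (by rw [covBy_unique hcov ha]; exact lt_irrefl _)
          · exact le_of_lt_covBy hcov hlt'
        rcases hyx with h4 | h4
        · exact h4 (aux hy hy2 hy')
        · exact h4 (aux hz hz2 hz')
      · exact hle h3
    · have h5 : x ≤ φ.toPartialEquiv y ⊓ φ.toPartialEquiv z :=
        le_inf ((CovBy.le hy).trans hy2) ((CovBy.le hz).trans hz2)
      refine h5.trans (le_of_lt_covBy hy' (lt_of_le_of_ne inf_le_left fun e => ?_))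
      exact hd.1 (inf_eq_left.1 e)
  have hfix : ∀ y x, x ≤ y → x ∈ φ.source → φ.toPartialEquiv y = y → φ.toPartialEquiv x = x := by
    intro y
    refine tree_induction (p := fun y => ∀ x, x ≤ y → x ∈ φ.source → φ.toPartialEquiv y = y →
      φ.toPartialEquiv x = x) ?_ ?_ y
    · intro x hx _ e
      rw [le_bot_iff.1 hx, e]
    · intro a b hab ih x hxb hx e
      rcases hxb.eq_or_lt with rfl | hlt
      · exact e
      · have hxa := le_of_lt_covBy hab hlt
        have := φ.covBy (φ.isUpperSet_source hxa hx) hab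
        rw [e] at this
        exact ih x hxa hx (covBy_unique this hab)
  apply h
  rw [one_def, mk_eq_mk, HonestAAut.equivalent_iff]
  refine ⟨φ.source, φ.source_eq, fun x hx => ⟨hx, trivial⟩, fun x hx => ?_⟩
  obtain ⟨y, hxy, hy⟩ := hT x
  exact hfix y x hxy hx (hbranch y (φ.isUpperSet_source hxy hx) hy)

end AAut

end Germs

/-! ### Colour-preserving isomorphisms between cylinders -/

namespace ColouringStructure

section Transport

variable {T : RootedTree.{u}} {L : Type v} {K : Type w} (𝒞 : T.ColouringStructure L K)

/-- The graph of the colour-preserving isomorphism between the trees of descendants of two vertices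
`x` and `y`: it relates `x` to `y`, and with any two vertices also those of their children that are
reached through edges of the same colour. -/
inductive Corr (x y : T) : T → T → Prop
  | base : Corr x y x y
  | step {z w z' w' : T} : Corr x y z w → z ⋖ z' → w ⋖ w' → 𝒞.ccol z' = 𝒞.ccol w' →
      Corr x y z' w'

variable {𝒞} {x y : T}

theorem label_eq_of_ccol_eq {z w z' w' : T} (hz : z ≠ ⊥) (hw : w ≠ ⊥) (hzz : z ⋖ z') (hww : w ⋖ w')
    (h : 𝒞.ccol z' = 𝒞.ccol w') : 𝒞.label z = 𝒞.label w ∧ 𝒞.label z' = 𝒞.label w' := by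
  have h1 := (𝒞.ccol_bijOn z hz _).mapsTo ⟨hzz, rfl⟩
  have h2 := (𝒞.ccol_bijOn w hw _).mapsTo ⟨hww, rfl⟩
  rw [h] at h1
  by_contra hne
  refine Set.disjoint_left.1 (𝒞.D_disjoint _ _ _ _ fun e => hne ?_) h1 h2
  exact Prod.mk.inj e

namespace Corr

theorem symm {z w : T} (h : 𝒞.Corr x y z w) : 𝒞.Corr y x w z := by
  induction h with
  | base => exact .base
  | step _ hz hw hc ih => exact ih.step hw hz hc.symm

theorem le_left {z w : T} (h : 𝒞.Corr x y z w) : x ≤ z := by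
  induction h with
  | base => exact le_rfl
  | step _ hz _ _ ih => exact ih.trans hz.le

theorem le_right {z w : T} (h : 𝒞.Corr x y z w) : y ≤ w := h.symm.le_left

theorem label_eq (hx : x ≠ ⊥) (hy : y ≠ ⊥) (hl : 𝒞.label x = 𝒞.label y) {z w : T}
    (h : 𝒞.Corr x y z w) : 𝒞.label z = 𝒞.label w := by
  cases h with
  | base => exact hl
  | step h hz hw hc =>
    exact (label_eq_of_ccol_eq (ne_bot_of_ne_bot_of_le hx h.le_left)
      (ne_bot_of_ne_bot_of_le hy h.le_right) hz hw hc).2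

theorem exists_child (hx : x ≠ ⊥) (hy : y ≠ ⊥) (hl : 𝒞.label x = 𝒞.label y) {z w z' : T}
    (h : 𝒞.Corr x y z w) (hz : z ⋖ z') : ∃ w', w ⋖ w' ∧ 𝒞.ccol z' = 𝒞.ccol w' := by
  have h1 := (𝒞.ccol_bijOn z (ne_bot_of_ne_bot_of_le hx h.le_left) _).mapsTo ⟨hz, rfl⟩
  rw [h.label_eq hx hy hl] at h1
  obtain ⟨w', hw', e⟩ :=
    (𝒞.ccol_bijOn w (ne_bot_of_ne_bot_of_le hy h.le_right) _).surjOn h1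
  exact ⟨w', hw'.1, e.symm⟩

theorem exists_of_le (hx : x ≠ ⊥) (hy : y ≠ ⊥) (hl : 𝒞.label x = 𝒞.label y) {z : T} (h : x ≤ z) :
    ∃ w, 𝒞.Corr x y z w := by
  revert h
  refine tree_induction (p := fun z => x ≤ z → ∃ w, 𝒞.Corr x y z w) ?_ ?_ z
  · intro h
    exact absurd (le_bot_iff.1 h) hx
  · intro a b hab ih hxb
    rcases hxb.eq_or_lt with rfl | hlt
    · exact ⟨y, .base⟩
    · obtain ⟨w, hw⟩ := ih (le_of_lt_covBy hab hlt)
      obtain ⟨w', hw', e⟩ := hw.exists_child hx hy hl hab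
      exact ⟨w', hw.step hab hw' e⟩

theorem unique (hy : y ≠ ⊥) {z w : T} (h : 𝒞.Corr x y z w) :
    ∀ {w' : T}, 𝒞.Corr x y z w' → w = w' := by
  induction h with
  | base =>
    intro w' h'
    cases h' with
    | base => rfl
    | step h hz _ _ => exact absurd h.le_left hz.lt.not_ge
  | @step a b z w h hz hw hc ih =>
    intro w' h'
    cases h' with
    | base => exact absurd h.le_left hz.lt.not_ge
    | @step a' b' _ _ h' hz' hw' hc' =>
      obtain rfl := covBy_unique hz hz'
      obtain rfl := ih h'
      have hb := ne_bot_of_ne_bot_of_le hy h.le_right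
      have e := hc.symm.trans hc'
      exact (𝒞.ccol_bijOn b hb _).injOn ⟨hw, rfl⟩
        ⟨hw', (label_eq_of_ccol_eq hb hb hw hw' e).2.symm⟩ e

theorem mono (hy : y ≠ ⊥) {z w z' w' : T} (h : 𝒞.Corr x y z w) (h' : 𝒞.Corr x y z' w')
    (hle : z ≤ z') : w ≤ w' := by
  induction h' with
  | base =>
    obtain rfl := le_antisymm hle h.le_left
    exact (h.unique hy .base).le
  | @step a b z' w' h' hz hw hc ih =>
    rcases hle.eq_or_lt with rfl | hlt
    · exact (h.unique hy (h'.step hz hw hc)).le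
    · exact (ih (le_of_lt_covBy hz hlt)).trans hw.le

end Corr

open Classical in
/-- The colour-preserving isomorphism from the tree of descendants of `x` to that of `y`, for two
non-root vertices `x` and `y` with the same label. Its values outside of `Ici x` are irrelevant. -/
noncomputable def transport (𝒞 : T.ColouringStructure L K) (x y z : T) : T :=
  if h : ∃ w, 𝒞.Corr x y z w then h.choose else z

/-- Two vertices that differ from the root and have the same label. -/
structure SameType (𝒞 : T.ColouringStructure L K) (x y : T) : Prop where
  left : x ≠ ⊥
  right : y ≠ ⊥
  label : 𝒞.label x = 𝒞.label y

namespace SameType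

theorem symm (h : 𝒞.SameType x y) : 𝒞.SameType y x := ⟨h.right, h.left, h.label.symm⟩

theorem corr (h : 𝒞.SameType x y) {z : T} (hz : x ≤ z) : 𝒞.Corr x y z (𝒞.transport x y z) := by
  have := Corr.exists_of_le h.left h.right h.label hz
  rw [transport, dif_pos this]
  exact this.choose_spec

theorem transport_eq (h : 𝒞.SameType x y) {z w : T} (hzw : 𝒞.Corr x y z w) :
    𝒞.transport x y z = w :=
  (h.corr hzw.le_left).unique h.right hzw

theorem le_transport (h : 𝒞.SameType x y) {z : T} (hz : x ≤ z) : y ≤ 𝒞.transport x y z :=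
  (h.corr hz).le_right

theorem transport_self (h : 𝒞.SameType x y) : 𝒞.transport x y x = y := h.transport_eq .base

theorem transport_transport (h : 𝒞.SameType x y) {z : T} (hz : x ≤ z) :
    𝒞.transport y x (𝒞.transport x y z) = z :=
  h.symm.transport_eq (h.corr hz).symm

theorem transport_mono (h : 𝒞.SameType x y) {z z' : T} (hz : x ≤ z) (hzz : z ≤ z') :
    𝒞.transport x y z ≤ 𝒞.transport x y z' :=
  (h.corr hz).mono h.right (h.corr (hz.trans hzz)) hzz

theorem ccol_transport (h : 𝒞.SameType x y) {z z' : T} (hz : x ≤ z) (hzz : z ⋖ z') :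
    𝒞.ccol (𝒞.transport x y z') = 𝒞.ccol z' := by
  obtain ⟨w', hw, e⟩ := (h.corr hz).exists_child h.left h.right h.label hzz
  rw [h.transport_eq ((h.corr hz).step hzz hw e), e]

end SameType

end Transport

/-! ### Exchanging two cylinders -/

section Swap

variable {T : RootedTree.{u}} {L : Type v} {K : Type w} {𝒞 : T.ColouringStructure L K} {x y : T}

open Classical in
/-- The map that exchanges the trees of descendants of `x` and `y`, preserving the colours. -/
noncomputable def swapFun (𝒞 : T.ColouringStructure L K) (x y z : T) : T :=
  if x ≤ z then 𝒞.transport x y z else if y ≤ z then 𝒞.transport y x z else z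

theorem swapFun_left {z : T} (h : x ≤ z) : 𝒞.swapFun x y z = 𝒞.transport x y z := if_pos h

theorem swapFun_right (hd : Disjoint (Ici x) (Ici y)) {z : T} (h : y ≤ z) :
    𝒞.swapFun x y z = 𝒞.transport y x z := by
  rw [swapFun, if_neg fun hx : x ≤ z => Set.disjoint_left.1 hd hx h, if_pos h]

theorem swapFun_of_not {z : T} (hx : ¬ x ≤ z) (hy : ¬ y ≤ z) : 𝒞.swapFun x y z = z := by
  rw [swapFun, if_neg hx, if_neg hy]

theorem swapFun_swapFun (h : 𝒞.SameType x y) (hd : Disjoint (Ici x) (Ici y)) (z : T) :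
    𝒞.swapFun x y (𝒞.swapFun x y z) = z := by
  by_cases hx : x ≤ z
  · rw [swapFun_left hx, swapFun_right hd (h.le_transport hx), h.transport_transport hx]
  · by_cases hy : y ≤ z
    · rw [swapFun_right hd hy, swapFun_left (h.symm.le_transport hy),
        h.symm.transport_transport hy]
    · rw [swapFun_of_not hx hy, swapFun_of_not hx hy]

theorem swapFun_mono (h : 𝒞.SameType x y) (hd : Disjoint (Ici x) (Ici y)) {z z' : T}
    (hzx : ¬ z < x) (hzy : ¬ z < y) (hz : z ≤ z') :
    𝒞.swapFun x y z ≤ 𝒞.swapFun x y z' := by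
  have key : ∀ a : T, ¬ z < a → ¬ a ≤ z → ¬ a ≤ z' := by
    intro a h1 h2 h3
    rcases le_total_of_directed hz h3 with h4 | h4
    · exact h2 h4
    · exact h1 (lt_of_le_of_ne h4 fun e => h2 e.ge)
  by_cases hx : x ≤ z
  · rw [swapFun_left hx, swapFun_left (hx.trans hz)]
    exact h.transport_mono hx hz
  · by_cases hy : y ≤ z
    · rw [swapFun_right hd hy, swapFun_right hd (hy.trans hz)]
      exact h.symm.transport_mono hy hz
    · rwa [swapFun_of_not hx hy, swapFun_of_not (key x hzx hx) (key y hzy hy)]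

theorem swapFun_mem (h : 𝒞.SameType x y) (hd : Disjoint (Ici x) (Ici y)) {z : T}
    (hz : ¬ z < x ∧ ¬ z < y) : ¬ 𝒞.swapFun x y z < x ∧ ¬ 𝒞.swapFun x y z < y := by
  obtain ⟨h1, h2⟩ := disjoint_Ici_iff.1 hd
  by_cases hx : x ≤ z
  · rw [swapFun_left hx]
    have := h.le_transport hx
    exact ⟨fun hlt => h2 (this.trans hlt.le), fun hlt => this.not_gt hlt⟩
  · by_cases hy : y ≤ z
    · rw [swapFun_right hd hy]
      have := h.symm.le_transport hy
      exact ⟨fun hlt => this.not_gt hlt, fun hlt => h1 (this.trans hlt.le)⟩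
    · rwa [swapFun_of_not hx hy]

variable [T.IsLocallyFinite]

/-- `swapFun` as an honest almost automorphism, defined away from the proper ancestors of `x`
and `y`. -/
noncomputable def swapHonest (hT : ∀ x : T, (T.children x).Nonempty) (h : 𝒞.SameType x y)
    (hd : Disjoint (Ici x) (Ici y)) : HonestAAut T where
  toFun := 𝒞.swapFun x y
  invFun := 𝒞.swapFun x y
  source := {z | ¬ z < x ∧ ¬ z < y}
  target := {z | ¬ z < x ∧ ¬ z < y}
  map_source' _ hz := swapFun_mem h hd hz
  map_target' _ hz := swapFun_mem h hd hz
  left_inv' z _ := swapFun_swapFun h hd z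
  right_inv' z _ := swapFun_swapFun h hd z
  source_eq := isForest_iff.2 ⟨fun a b hab ha => ⟨fun hb => ha.1 (hab.trans_lt hb),
    fun hb => ha.2 (hab.trans_lt hb)⟩, ((finite_Iic x).union (finite_Iic y)).subset (by
      intro z hz
      by_contra hn
      exact hz ⟨fun hlt => hn (Or.inl hlt.le), fun hlt => hn (Or.inr hlt.le)⟩), fun x _ => hT x⟩
  target_eq := isForest_iff.2 ⟨fun a b hab ha => ⟨fun hb => ha.1 (hab.trans_lt hb),
    fun hb => ha.2 (hab.trans_lt hb)⟩, ((finite_Iic x).union (finite_Iic y)).subset (by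
      intro z hz
      by_contra hn
      exact hz ⟨fun hlt => hn (Or.inl hlt.le), fun hlt => hn (Or.inr hlt.le)⟩), fun x _ => hT x⟩
  le_iff a ha b hb := by
    refine ⟨fun hle => ?_, fun hle => swapFun_mono h hd ha.1 ha.2 hle⟩
    have ha' := swapFun_mem h hd ha
    have := swapFun_mono h hd ha'.1 ha'.2 hle
    rwa [swapFun_swapFun h hd, swapFun_swapFun h hd] at this

/-- For incomparable vertices `x` and `y` of the same label, `V_𝒞` contains the involution that
exchanges their cylinders. -/
theorem exists_swap (hT : ∀ x : T, (T.children x).Nonempty) (h : 𝒞.SameType x y)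
    (hd : Disjoint (Ici x) (Ici y)) :
    ∃ s ∈ 𝒞.V, s ∈ AAut.supportedIn (Ici x ∪ Ici y) ∧ s.MapsTo (Ici x) (Ici y) ∧
      ∀ᶠ z in cofinite, x ≤ z → s.rep z = 𝒞.transport x y z := by
  have hrep := AAut.rep_mk (swapHonest hT h hd)
  have hleft : ∀ᶠ z in cofinite, x ≤ z →
      (AAut.mk (swapHonest hT h hd)).rep z = 𝒞.transport x y z := by
    filter_upwards [hrep] with z hz hxz
    rw [hz]
    exact swapFun_left hxz
  refine ⟨AAut.mk (swapHonest hT h hd), ⟨_, rfl, ?_⟩, ?_, ?_, hleft⟩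
  · rintro z ⟨hzx, hzy⟩
    have hz0 : z ≠ ⊥ := by
      rintro rfl
      exact hzx (bot_lt_iff_ne_bot.2 h.left)
    change (𝒞.swapFun x y z = ⊥ ↔ z = ⊥) ∧
      (z ≠ ⊥ → ∀ z', z ⋖ z' → 𝒞.ccol (𝒞.swapFun x y z') = 𝒞.ccol z')
    refine ⟨iff_of_false (fun e => ?_) hz0, fun _ z' hz' => ?_⟩
    · have := (swapFun_mem h hd ⟨hzx, hzy⟩).1
      rw [e] at this
      exact this (bot_lt_iff_ne_bot.2 h.left)
    · by_cases hx : x ≤ z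
      · rw [swapFun_left (hx.trans hz'.le), h.ccol_transport hx hz']
      · by_cases hy : y ≤ z
        · rw [swapFun_right hd (hy.trans hz'.le), h.symm.ccol_transport hy hz']
        · have key : ∀ a : T, ¬ z < a → ¬ a ≤ z → ¬ a ≤ z' := by
            intro a h1 h2 h3
            rcases h3.eq_or_lt with rfl | h4
            · exact h1 hz'.lt
            · exact h2 (le_of_lt_covBy hz' h4)
          rw [swapFun_of_not (key x hzx hx) (key y hzy hy)]
  · refine AAut.mem_supportedIn.2 ?_
    filter_upwards [hrep] with z hz hzA
    rw [hz]
    exact swapFun_of_not (fun hx => hzA (Or.inl hx)) (fun hy => hzA (Or.inr hy))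
  · filter_upwards [hleft] with z hz hxz
    rw [hz hxz]
    exact h.le_transport hxz

end Swap

/-! ### Abundance of vertices and elements that move finitely many cylinders -/

section Moves

variable {T : RootedTree.{u}} {L : Type v} {K : Type w} {𝒞 : T.ColouringStructure L K} {x : T}

variable (𝒞) in
theorem exists_label_above (hx : x ≠ ⊥) (l : L) : ∃ y, x ≤ y ∧ 𝒞.label y = l := by
  by_contra hne
  push Not at hne
  have := 𝒞.label_spanning l {y | ¬ x ≤ y} (fun a b hba ha hb => ha (hb.trans hba))
    (fun h => hx (le_bot_iff.1 h)) (fun y _ hy hxy => hne y hxy hy)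
  have h2 : x ∈ {y | ¬ x ≤ y} := this ▸ mem_univ x
  exact h2 le_rfl

theorem exists_branching_above (𝒞 : T.ColouringStructure L K)
    (hnc : ∃ x : T, x ≠ ⊥ ∧ (T.children x).Nontrivial) (x : T) :
    ∃ y, x ≤ y ∧ (T.children y).Nontrivial := by
  obtain ⟨a, ha, hn⟩ := hnc
  by_cases hx : x = ⊥
  · exact ⟨a, hx ▸ bot_le, hn⟩
  · obtain ⟨y, hxy, hy⟩ := 𝒞.exists_label_above hx (𝒞.label a)
    refine ⟨y, hxy, ?_⟩
    obtain ⟨α, -⟩ := 𝒞.label_children a y ha (ne_bot_of_ne_bot_of_le hx hxy) hy.symm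
    obtain ⟨b, hb, c, hc, hbc⟩ := hn
    exact ⟨_, (α ⟨b, hb⟩).2, _, (α ⟨c, hc⟩).2, fun e =>
      hbc (congrArg Subtype.val (α.injective (Subtype.ext e)))⟩

theorem exists_pair_above (𝒞 : T.ColouringStructure L K)
    (hnc : ∃ x : T, x ≠ ⊥ ∧ (T.children x).Nontrivial) (x : T) :
    ∃ y z, x ≤ y ∧ x ≤ z ∧ Disjoint (Ici y) (Ici z) := by
  obtain ⟨a, hxa, b, hb, c, hc, hbc⟩ := 𝒞.exists_branching_above hnc x
  exact ⟨b, c, hxa.trans (CovBy.le hb), hxa.trans (CovBy.le hc), disjoint_Ici_of_covBy hb hc hbc⟩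

theorem exists_triple_above (𝒞 : T.ColouringStructure L K)
    (hnc : ∃ x : T, x ≠ ⊥ ∧ (T.children x).Nontrivial) (x : T) :
    ∃ a b c, x ≤ a ∧ x ≤ b ∧ x ≤ c ∧ Disjoint (Ici a) (Ici b) ∧ Disjoint (Ici a) (Ici c) ∧
      Disjoint (Ici b) (Ici c) := by
  obtain ⟨a, d, ha, hd, had⟩ := 𝒞.exists_pair_above hnc x
  obtain ⟨b, c, hb, hc, hbc⟩ := 𝒞.exists_pair_above hnc d
  exact ⟨a, b, c, ha, hd.trans hb, hd.trans hc, disjoint_Ici_mono had le_rfl hb,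
    disjoint_Ici_mono had le_rfl hc, hbc⟩

variable [T.IsLocallyFinite]

/-- Finitely many disjoint cylinders can be moved into any given cylinder that is disjoint from all
of them. -/
theorem exists_move (hnc : ∃ x : T, x ≠ ⊥ ∧ (T.children x).Nontrivial) (Y : Finset T)
    (hY : (Y : Set T).PairwiseDisjoint Ici) :
    ∀ w : T, w ≠ ⊥ → (∀ y ∈ Y, Disjoint (Ici y) (Ici w)) →
      ∃ s ∈ 𝒞.V, s ∈ AAut.supportedIn ((⋃ y ∈ Y, Ici y) ∪ Ici w) ∧
        s.MapsTo (⋃ y ∈ Y, Ici y) (Ici w) := by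
  classical
  induction Y using Finset.induction_on with
  | empty =>
    intro w _ _
    refine ⟨1, one_mem _, one_mem _, ?_⟩
    simp [AAut.MapsTo]
  | insert y Y hyY ih =>
    intro w hw0 hw
    obtain ⟨w₁, w₂, h1, h2, h12⟩ := 𝒞.exists_pair_above hnc w
    have hyw : Disjoint (Ici y) (Ici w) := hw y (Finset.mem_insert_self _ _)
    have hw' : ∀ z ∈ Y, Disjoint (Ici z) (Ici w) := fun z hz => hw z (Finset.mem_insert_of_mem hz)
    obtain ⟨s, hsV, hs, hsm⟩ := ih (hY.subset (by simp)) w₁ (ne_bot_of_ne_bot_of_le hw0 h1)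
      fun z hz => disjoint_Ici_mono (hw' z hz) le_rfl h1
    obtain ⟨w₃, h3, hl⟩ := 𝒞.exists_label_above (ne_bot_of_ne_bot_of_le hw0 h2) (𝒞.label y)
    obtain ⟨t, htV, ht, htm, -⟩ := exists_swap (𝒞 := 𝒞) (x := y) (y := w₃)
      (𝒞.exists_child hnc)
      ⟨ne_bot_of_disjoint_Ici hyw, ne_bot_of_ne_bot_of_le hw0 (h2.trans h3), hl.symm⟩
      (disjoint_Ici_mono hyw le_rfl (h2.trans h3))
    have hyU : Disjoint (⋃ z ∈ Y, Ici z) (Ici y) := by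
      simp only [disjoint_iUnion_left]
      intro z hz
      refine hY (by simp [hz]) (by simp) ?_
      rintro rfl
      exact hyY hz
    refine ⟨t * s, mul_mem htV hsV, mul_mem ?_ ?_, ?_⟩
    · refine AAut.supportedIn_mono (union_subset_union ?_ (Ici_subset_Ici.2 (h2.trans h3))) ht
      exact subset_biUnion_of_mem (u := fun z => Ici z) (Finset.mem_insert_self y Y)
    · refine AAut.supportedIn_mono (union_subset_union ?_ (Ici_subset_Ici.2 h1)) hs
      exact biUnion_subset_biUnion_left fun z hz => Finset.mem_insert_of_mem hz
    · rw [Finset.set_biUnion_insert, ← union_self (Ici w)]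
      refine AAut.MapsTo.union ?_ ?_
      · refine AAut.MapsTo.mul (htm.mono subset_rfl (Ici_subset_Ici.2 (h2.trans h3)))
          (AAut.mapsTo_of_disjoint hs ?_)
        exact disjoint_union_left.2 ⟨hyU, (disjoint_Ici_mono hyw le_rfl h1).symm⟩
      · refine AAut.MapsTo.mul ?_ hsm
        refine (AAut.mapsTo_of_disjoint ht ?_).mono subset_rfl (Ici_subset_Ici.2 h1)
        exact disjoint_union_left.2 ⟨disjoint_Ici_mono hyw le_rfl h1,
          (disjoint_Ici_mono h12 le_rfl h3).symm⟩

/-- The element of `exists_move` can be chosen in the commutator subgroup: if `s` and `r` move `Y`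
into disjoint parts of the cylinder of `w`, then `r * s⁻¹ * r⁻¹` is the identity on `Y`, so that
`⁅s, r⁆` agrees with `s` there. -/
theorem exists_commutator_move (hnc : ∃ x : T, x ≠ ⊥ ∧ (T.children x).Nontrivial) (Y : Finset T)
    (hY : (Y : Set T).PairwiseDisjoint Ici) {w : T} (hw0 : w ≠ ⊥)
    (hw : ∀ y ∈ Y, Disjoint (Ici y) (Ici w)) :
    ∃ d ∈ ⁅𝒞.V, 𝒞.V⁆, d.MapsTo (⋃ y ∈ Y, Ici y) (Ici w) := by
  obtain ⟨w₁, w₂, h1, h2, h12⟩ := 𝒞.exists_pair_above hnc w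
  obtain ⟨s, hsV, hs, hsm⟩ := exists_move (𝒞 := 𝒞) hnc Y hY w₁ (ne_bot_of_ne_bot_of_le hw0 h1)
    fun z hz => disjoint_Ici_mono (hw z hz) le_rfl h1
  obtain ⟨r, hrV, hr, hrm⟩ := exists_move (𝒞 := 𝒞) hnc Y hY w₂ (ne_bot_of_ne_bot_of_le hw0 h2)
    fun z hz => disjoint_Ici_mono (hw z hz) le_rfl h2
  have hU : Disjoint (⋃ y ∈ Y, Ici y) (Ici w) := by
    simp only [disjoint_iUnion_left]
    exact hw
  refine ⟨⁅s, r⁆, Subgroup.commutator_mem_commutator hsV hrV, ?_⟩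
  have hr1 : r.MapsTo (Ici w₁) (Ici w₁) := AAut.mapsTo_of_disjoint hr
    (disjoint_union_left.2 ⟨hU.mono_right (Ici_subset_Ici.2 h1), h12.symm⟩)
  have hc := AAut.conj_mem_supportedIn (hrm.union hr1) (inv_mem hs)
  have e : ⁅s, r⁆ = s * (r * s⁻¹ * r⁻¹) := by simp only [commutatorElement_def, mul_assoc]
  rw [e]
  refine AAut.MapsTo.mul (hsm.mono subset_rfl (Ici_subset_Ici.2 h1))
    (AAut.mapsTo_of_disjoint hc ?_)
  exact (disjoint_union_right.2 ⟨hU.mono_right (Ici_subset_Ici.2 h2),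
    hU.mono_right (Ici_subset_Ici.2 h1)⟩).symm

end Moves

end ColouringStructure

/-! ### Density of `V_𝒞` -/

section Density

variable {T : RootedTree.{u}}

open Classical in
/-- The minimal vertex of the forest `s` below `z`, if `z` is in `s`. -/
noncomputable def minimalBelow (s : Set T) (z : T) : T :=
  if h : ∃ m ∈ Patterning.minimals s, m ≤ z then h.choose else z

theorem minimalBelow_eq {s : Set T} (hs : IsUpperSet s) {m z : T} (hm : m ∈ Patterning.minimals s)
    (hz : m ≤ z) : minimalBelow s z = m := by
  have h : ∃ m ∈ Patterning.minimals s, m ≤ z := ⟨m, hm, hz⟩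
  have key : ∀ a ∈ Patterning.minimals s, ∀ b ∈ Patterning.minimals s, a ≤ b → a = b := by
    intro a ha b hb hab
    by_contra hne
    have hlt := lt_of_le_of_ne hab hne
    have hc : Order.pred b ⋖ b := Order.pred_covBy_of_not_isMin fun hmin => hmin.not_lt hlt
    exact hb.2 _ hc (hs (le_of_lt_covBy hc hlt) ha.1)
  rw [minimalBelow, dif_pos h]
  obtain ⟨h1, h2⟩ := h.choose_spec
  rcases le_total_of_directed h2 hz with h3 | h3
  exacts [(key _ hm _ h1 h3).symm, key _ h1 _ hm h3]

theorem exists_minimals_le {s : Set T} {z : T} (hz : z ∈ s) :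
    ∃ m ∈ Patterning.minimals s, m ≤ z := by
  obtain ⟨m, hm, hmz, h⟩ := exists_minimal_le hz
  exact ⟨m, ⟨hm, h⟩, hmz⟩

variable [T.IsLocallyFinite]

/-- The restriction of an honest almost automorphism to a smaller forest. -/
def HonestAAut.restrict (φ : HonestAAut T) (s : Set T)
    (hs : ∃ S : CompleteSubtree T, s = S.forest) : HonestAAut T where
  toPartialEquiv := φ.toPartialEquiv.restr s
  source_eq := isForest_inter φ.source_eq hs
  target_eq := φ.symm.isForest_preimage φ.target_eq subset_rfl hs
  le_iff x hx y hy := φ.le_iff x hx.1 y hy.1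

theorem AAut.mk_restrict (φ : HonestAAut T) (s : Set T)
    (hs : ∃ S : CompleteSubtree T, s = S.forest) : AAut.mk (φ.restrict s hs) = AAut.mk φ := by
  rw [mk_eq_mk, HonestAAut.equivalent_iff]
  exact ⟨_, (φ.restrict s hs).source_eq, fun x hx => ⟨hx, hx.1⟩, fun x _ => rfl⟩

variable {L : Type v} {K : Type w} {𝒞 : T.ColouringStructure L K}

theorem ColouringStructure.ChildColourPreservingOn.patterningOn (P : Patterning 𝒞)
    (hT : ∀ x : T, (T.children x).Nonempty) {φ : HonestAAut T}
    (hφ : 𝒞.ChildColourPreservingOn φ.toPartialEquiv φ.source) :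
    P.PatterningOn φ.toPartialEquiv φ.source := by
  refine fun x hx => ⟨(hφ x hx).1, fun h0 => ⟨?_, 1, one_mem _, fun y hy d hd => ?_⟩⟩
  · obtain ⟨y, hy⟩ := hT x
    exact (label_eq_of_ccol_eq (fun h' => h0 ((hφ x hx).1.1 h')) h0 (φ.covBy hx hy) hy
      ((hφ x hx).2 h0 y hy)).1
  · rw [(hφ x hx).2 h0 y hy]
    exact hd.symm

open Classical in
/-- On the tree of descendants of a minimal vertex `m` of the domain of `φ`, the composition of the
colour-preserving isomorphism onto the tree of descendants of `φ m` with the inverse of `φ`; the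
identity outside of the domain. -/
noncomputable def straighten (𝒞 : T.ColouringStructure L K) (φ : HonestAAut T) (z : T) : T :=
  if z ∈ φ.source then φ.toPartialEquiv.symm (𝒞.transport (minimalBelow φ.source z)
    (φ.toPartialEquiv (minimalBelow φ.source z)) z) else z

open Classical in
/-- The inverse of `straighten`. -/
noncomputable def straightenInv (𝒞 : T.ColouringStructure L K) (φ : HonestAAut T) (z : T) : T :=
  if z ∈ φ.source then 𝒞.transport (φ.toPartialEquiv (minimalBelow φ.source z))
    (minimalBelow φ.source z) (φ.toPartialEquiv z) else z

section Straighten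

variable {φ : HonestAAut T} {m z : T}

omit [T.IsLocallyFinite] in
theorem straighten_of_notMem (h : z ∉ φ.source) : straighten 𝒞 φ z = z := if_neg h

omit [T.IsLocallyFinite] in
theorem straightenInv_of_notMem (h : z ∉ φ.source) : straightenInv 𝒞 φ z = z := if_neg h

theorem straightenInv_eq (hm : m ∈ Patterning.minimals φ.source) (hz : m ≤ z) :
    straightenInv 𝒞 φ z = 𝒞.transport (φ.toPartialEquiv m) m (φ.toPartialEquiv z) := by
  rw [straightenInv, if_pos (φ.isUpperSet_source hz hm.1),
    minimalBelow_eq φ.isUpperSet_source hm hz]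

theorem map_le_map (hm : m ∈ φ.source) (hz : m ≤ z) : φ.toPartialEquiv m ≤ φ.toPartialEquiv z :=
  (φ.le_iff m hm z (φ.isUpperSet_source hz hm)).2 hz

variable (h : ∀ m ∈ Patterning.minimals φ.source, 𝒞.SameType m (φ.toPartialEquiv m))

include h

theorem map_straighten (hm : m ∈ Patterning.minimals φ.source) (hz : m ≤ z) :
    φ.toPartialEquiv (straighten 𝒞 φ z) = 𝒞.transport m (φ.toPartialEquiv m) z := by
  rw [straighten, if_pos (φ.isUpperSet_source hz hm.1),
    minimalBelow_eq φ.isUpperSet_source hm hz, φ.right_inv]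
  exact φ.isUpperSet_target ((h m hm).le_transport hz) (φ.map_source hm.1)

theorem le_straighten (hm : m ∈ Patterning.minimals φ.source) (hz : m ≤ z) :
    m ≤ straighten 𝒞 φ z := by
  have ht := (h m hm).le_transport hz
  have htt := φ.isUpperSet_target ht (φ.map_source hm.1)
  rw [straighten, if_pos (φ.isUpperSet_source hz hm.1),
    minimalBelow_eq φ.isUpperSet_source hm hz, ← φ.le_iff m hm.1 _ (φ.map_target htt)]
  rwa [φ.right_inv htt]

theorem le_straightenInv (hm : m ∈ Patterning.minimals φ.source) (hz : m ≤ z) :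
    m ≤ straightenInv 𝒞 φ z := by
  rw [straightenInv_eq hm hz]
  exact (h m hm).symm.le_transport (map_le_map hm.1 hz)

theorem straighten_straightenInv (z : T) : straighten 𝒞 φ (straightenInv 𝒞 φ z) = z := by
  by_cases hz : z ∈ φ.source
  · obtain ⟨m, hm, hmz⟩ := exists_minimals_le hz
    have h1 := le_straightenInv h hm hmz
    refine φ.injOn (φ.isUpperSet_source (le_straighten h hm h1) hm.1) hz ?_
    rw [map_straighten h hm h1, straightenInv_eq hm hmz,
      (h m hm).symm.transport_transport (map_le_map hm.1 hmz)]
  · rw [straightenInv_of_notMem hz, straighten_of_notMem hz]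

theorem straightenInv_straighten (z : T) : straightenInv 𝒞 φ (straighten 𝒞 φ z) = z := by
  by_cases hz : z ∈ φ.source
  · obtain ⟨m, hm, hmz⟩ := exists_minimals_le hz
    rw [straightenInv_eq hm (le_straighten h hm hmz), map_straighten h hm hmz,
      (h m hm).transport_transport hmz]
  · rw [straighten_of_notMem hz, straightenInv_of_notMem hz]

omit h in
theorem monotone_of_minimals {f : T → T} (h1 : ∀ z, z ∉ φ.source → f z = z)
    (h2 : ∀ m ∈ Patterning.minimals φ.source, ∀ z, m ≤ z → m ≤ f z)
    (h3 : ∀ m ∈ Patterning.minimals φ.source, ∀ z z', m ≤ z → z ≤ z' → f z ≤ f z') :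
    Monotone f := by
  intro z z' hzz
  by_cases hz : z ∈ φ.source
  · obtain ⟨m, hm, hmz⟩ := exists_minimals_le hz
    exact h3 m hm z z' hmz hzz
  · rw [h1 z hz]
    by_cases hz' : z' ∈ φ.source
    · obtain ⟨m, hm, hmz⟩ := exists_minimals_le hz'
      have hzm : z ≤ m := by
        rcases le_total_of_directed hzz hmz with h' | h'
        · exact absurd (φ.isUpperSet_source h' hm.1) hz
        · exact h'
      exact hzm.trans (h2 m hm z' hmz)
    · rwa [h1 z' hz']

/-- `straighten` as an automorphism of the tree. -/
noncomputable def straightenIso : T ≃o T :=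
  Equiv.toOrderIso ⟨straighten 𝒞 φ, straightenInv 𝒞 φ, straightenInv_straighten h,
    straighten_straightenInv h⟩
    (monotone_of_minimals (φ := φ) (fun _ => straighten_of_notMem)
      (fun m hm z hz => le_straighten h hm hz) (by
        intro m hm z z' hz hzz
        have hmem : ∀ a, m ≤ a → straighten 𝒞 φ a ∈ φ.source := fun a ha =>
          φ.isUpperSet_source (le_straighten h hm ha) hm.1
        change straighten 𝒞 φ z ≤ straighten 𝒞 φ z'
        rw [← φ.le_iff _ (hmem z hz) _ (hmem z' (hz.trans hzz))]
        rw [map_straighten h hm hz, map_straighten h hm (hz.trans hzz)]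
        exact (h m hm).transport_mono hz hzz))
    (monotone_of_minimals (φ := φ) (fun _ => straightenInv_of_notMem)
      (fun m hm z hz => le_straightenInv h hm hz) (by
        intro m hm z z' hz hzz
        change straightenInv 𝒞 φ z ≤ straightenInv 𝒞 φ z'
        rw [straightenInv_eq hm hz, straightenInv_eq hm (hz.trans hzz)]
        exact (h m hm).symm.transport_mono (map_le_map hm.1 hz)
          (map_le_map (φ.isUpperSet_source hz hm.1) hzz)))

theorem straighten_mem_source_iff : straighten 𝒞 φ z ∈ φ.source ↔ z ∈ φ.source := by
  constructor
  · intro hz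
    by_contra hz'
    rw [straighten_of_notMem hz'] at hz
    exact hz' hz
  · intro hz
    obtain ⟨m, hm, hmz⟩ := exists_minimals_le hz
    exact φ.isUpperSet_source (le_straighten h hm hmz) hm.1

theorem childColourPreservingOn_comp_straightenIso :
    𝒞.ChildColourPreservingOn (φ.comp (.ofAut (straightenIso h))).toPartialEquiv
      (φ.comp (.ofAut (straightenIso h))).source := by
  rintro z ⟨-, hz⟩
  obtain ⟨m, hm, hmz⟩ := exists_minimals_le ((straighten_mem_source_iff h).1 hz)
  change (φ.toPartialEquiv (straighten 𝒞 φ z) = ⊥ ↔ z = ⊥) ∧ (z ≠ ⊥ → ∀ y, z ⋖ y →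
    𝒞.ccol (φ.toPartialEquiv (straighten 𝒞 φ y)) = 𝒞.ccol y)
  have hs := h m hm
  rw [map_straighten h hm hmz]
  refine ⟨iff_of_false (ne_bot_of_ne_bot_of_le hs.right (hs.le_transport hmz))
    (ne_bot_of_ne_bot_of_le hs.left hmz), fun _ y hy => ?_⟩
  rw [map_straighten h hm (hmz.trans hy.le)]
  exact hs.ccol_transport hmz hy

theorem straightenIso_mem_AutP (hT : ∀ x : T, (T.children x).Nonempty) (P : Patterning 𝒞)
    (hφ : P.PatterningOn φ.toPartialEquiv φ.source) : straightenIso h ∈ P.AutP := by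
  intro z _
  refine ⟨by simp, fun h0 => ?_⟩
  change 𝒞.label (straighten 𝒞 φ z) = _ ∧ P.LocalPermMem (straighten 𝒞 φ) z
  -- The children of vertices outside of the domain are fixed, being outside or minimal.
  have hfix : ∀ y, z ⋖ y → z ∉ φ.source → straighten 𝒞 φ y = y := by
    intro y hy hz
    by_cases hys : y ∈ φ.source
    · have hm : y ∈ Patterning.minimals φ.source := by
        refine ⟨hys, fun p hp => ?_⟩
        rwa [covBy_unique hp hy]
      refine φ.injOn ((straighten_mem_source_iff h).2 hys) hys ?_
      rw [map_straighten h hm le_rfl, (h y hm).transport_self]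
    · exact straighten_of_notMem hys
  by_cases hz : z ∈ φ.source
  · have hzs := (straighten_mem_source_iff h).2 hz
    have hψ := (childColourPreservingOn_comp_straightenIso h).patterningOn P hT
    obtain ⟨h1, σ, hσ, H⟩ :=
      ((hφ.symm.comp hψ) z ⟨⟨trivial, hzs⟩, φ.map_source hzs⟩).2 h0
    have e : ∀ y ∈ φ.source, φ.toPartialEquiv.symm (φ.toPartialEquiv (straighten 𝒞 φ y)) =
        straighten 𝒞 φ y := fun y hy => φ.left_inv ((straighten_mem_source_iff h).2 hy)
    refine ⟨?_, σ, hσ, fun y hy d hd => ?_⟩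
    · rw [← e z hz]
      exact h1
    · rw [← e y (φ.isUpperSet_source hy.le hz)]
      exact H y hy d hd
  · rw [straighten_of_notMem hz]
    refine ⟨rfl, 1, one_mem _, fun y hy d hd => ?_⟩
    rw [hfix y hy hz]
    exact hd.symm

end Straighten

/-- Every element of `AAut_𝒫(T)` differs from an element of `V_𝒞` by a patterning automorphism of
the tree that fixes any prescribed finite set of vertices. -/
theorem Patterning.exists_mul_ofAut_mem_V (hT : ∀ x : T, (T.children x).Nonempty) (P : Patterning 𝒞)
    {g : AAut T} (hg : g ∈ P.AAutP) {S : Set T} (hS : S.Finite) :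
    ∃ α ∈ P.AutP, (∀ x ∈ S, α x = x) ∧ g * AAut.ofAut α ∈ 𝒞.V := by
  obtain ⟨φ, rfl, hφ⟩ := hg
  -- The representative is restricted to a forest without the root and without vertices of `S`.
  have hs : (insert ⊥ S)ᶜ ∈ (cofinite : Filter T) := by
    rw [mem_cofinite, compl_compl]
    exact hS.insert ⊥
  obtain ⟨t, ht, hts⟩ := exists_forest_of_mem_cofinite hT hs
  have hψ : P.PatterningOn (φ.restrict t ht).toPartialEquiv (φ.restrict t ht).source :=
    fun x hx => hφ x hx.1
  have hne : ∀ x ∈ (φ.restrict t ht).source, x ≠ ⊥ := by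
    rintro x hx rfl
    exact hts hx.2 (Or.inl rfl)
  rw [← AAut.mk_restrict φ t ht]
  have h : ∀ m ∈ Patterning.minimals (φ.restrict t ht).source,
      𝒞.SameType m ((φ.restrict t ht).toPartialEquiv m) := by
    intro m hm
    have h0 := hne m hm.1
    exact ⟨h0, fun e => h0 ((hψ m hm.1).1.1 e), ((hψ m hm.1).2 h0).1.symm⟩
  refine ⟨straightenIso h, straightenIso_mem_AutP h hT P hψ, fun x hx => ?_, _, rfl,
    childColourPreservingOn_comp_straightenIso h⟩
  exact straighten_of_notMem fun hx' => hts hx'.2 (Or.inr hx)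

theorem Patterning.dense_V (hnc : ∃ x : T, x ≠ ⊥ ∧ (T.children x).Nontrivial) (P : Patterning 𝒞) :
    Dense (𝒞.V.subgroupOf P.AAutP : Set P.AAutP) := by
  intro g
  rw [mem_closure_iff_nhds_basis (P.basis.nhds_hasBasis g)]
  rintro _ ⟨S, hS, rfl⟩
  obtain ⟨α, hα, hαS, hV⟩ := P.exists_mul_ofAut_mem_V (𝒞.exists_child hnc) g.2 hS
  have hαP : AAut.ofAut α ∈ P.AAutP := ⟨.ofAut α, rfl, hα⟩
  exact ⟨g * ⟨_, hαP⟩, hV, ⟨_, hαP⟩, ⟨α, hα, hαS, rfl⟩, rfl⟩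

end Density

/-- Commutators of elements of a dense subgroup are dense among all commutators. -/
theorem topologicalClosure_commutator_of_dense {G : Type*} [Group G] [TopologicalSpace G]
    [IsTopologicalGroup G] {H : Subgroup G} (hH : Dense (H : Set G)) :
    ⁅(⊤ : Subgroup G), (⊤ : Subgroup G)⁆.topologicalClosure = ⁅H, H⁆.topologicalClosure := by
  apply le_antisymm
  · refine Subgroup.topologicalClosure_minimal _ ?_ (Subgroup.isClosed_topologicalClosure _)
    have hc := Subgroup.isClosed_topologicalClosure ⁅H, H⁆
    have hcont : Continuous fun p : G × G => ⁅p.1, p.2⁆ := by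
      simp only [commutatorElement_def]
      fun_prop
    have h1 : ∀ a ∈ H, ∀ b, ⁅a, b⁆ ∈ ⁅H, H⁆.topologicalClosure := by
      intro a ha b
      have hcl : IsClosed {b | ⁅a, b⁆ ∈ ⁅H, H⁆.topologicalClosure} :=
        hc.preimage (hcont.comp (by fun_prop : Continuous fun b => (a, b)))
      exact hcl.closure_subset_iff.2 (fun b hb => Subgroup.le_topologicalClosure _
        (Subgroup.commutator_mem_commutator ha hb)) (hH b)
    refine Subgroup.commutator_le.2 fun a _ b _ => ?_
    have hcl : IsClosed {a | ⁅a, b⁆ ∈ ⁅H, H⁆.topologicalClosure} :=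
      hc.preimage (hcont.comp (by fun_prop : Continuous fun a => (a, b)))
    exact hcl.closure_subset_iff.2 (fun a ha => h1 a ha b) (hH a)
  · exact Subgroup.topologicalClosure_mono (Subgroup.commutator_mono le_top le_top)

/-! ### Commutators of elements with small support -/

section Simplicity

variable {T : RootedTree.{u}}

theorem exists_ge_mem_of_mem_cofinite (hT : ∀ x : T, (T.children x).Nonempty) {s : Set T}
    (hs : s ∈ (cofinite : Filter T)) (u : T) : ∃ z ∈ s, u ≤ z := by
  by_contra hne
  push Not at hne
  have hfin : (Ici u).Finite := (mem_cofinite.1 hs).subset fun z hz hzs => hne z hzs hz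
  obtain ⟨m, hm⟩ := hfin.exists_maximal ⟨u, le_refl u⟩
  obtain ⟨z, hz⟩ := hT m
  exact (CovBy.lt hz).not_ge (hm.2 (hm.1.trans (CovBy.le hz)) (CovBy.le hz))

theorem commutatorElement_mul_left_of_commute {G : Type*} [Group G] {a b k : G}
    (h : Commute k b) : ⁅a * k, b⁆ = ⁅a, b⁆ := by
  have : k * b * k⁻¹ = b := by rw [h.eq, mul_inv_cancel_right]
  calc ⁅a * k, b⁆ = a * (k * b * k⁻¹) * a⁻¹ * b⁻¹ := by simp only [commutatorElement_def]; group
    _ = ⁅a, b⁆ := by rw [this, commutatorElement_def]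

theorem commutatorElement_mul_right_of_commute {G : Type*} [Group G] {a b k : G}
    (h : Commute k a) : ⁅a, b * k⁆ = ⁅a, b⁆ := by
  rw [← commutatorElement_inv, commutatorElement_mul_left_of_commute h, commutatorElement_inv]

theorem conj_commutatorElement {G : Type*} [Group G] (d a b : G) :
    d * ⁅a, b⁆ * d⁻¹ = ⁅d * a * d⁻¹, d * b * d⁻¹⁆ := by
  simp only [commutatorElement_def]
  group

namespace ColouringStructure

variable [T.IsLocallyFinite] {L : Type v} {K : Type w} {𝒞 : T.ColouringStructure L K}

/-- The elements of `V_𝒞` that fix almost all descendants of `u`. -/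
def fixCylinder (𝒞 : T.ColouringStructure L K) (u : T) : Subgroup (AAut T) :=
  𝒞.V ⊓ AAut.supportedIn (Ici u)ᶜ

theorem fixCylinder_mono {u u' : T} (h : u ≤ u') : 𝒞.fixCylinder u ≤ 𝒞.fixCylinder u' :=
  inf_le_inf_left _ (AAut.supportedIn_mono (compl_subset_compl.2 (Ici_subset_Ici.2 h)))

theorem mem_fixCylinder {a : AAut T} {A : Set T} {u : T} (ha : a ∈ 𝒞.V)
    (hA : a ∈ AAut.supportedIn A) (h : Disjoint A (Ici u)) : a ∈ 𝒞.fixCylinder u :=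
  ⟨ha, AAut.supportedIn_mono h.subset_compl_right hA⟩

/-- The subgroup generated by the commutators of any two elements of `V_𝒞` that both fix almost all
descendants of some non-root vertex. -/
def localCommutator (𝒞 : T.ColouringStructure L K) : Subgroup (AAut T) :=
  Subgroup.closure {c | ∃ u : T, u ≠ ⊥ ∧ ∃ a ∈ 𝒞.fixCylinder u, ∃ b ∈ 𝒞.fixCylinder u, ⁅a, b⁆ = c}

theorem commutator_mem_localCommutator {u : T} (hu : u ≠ ⊥) {a b : AAut T}
    (ha : a ∈ 𝒞.fixCylinder u) (hb : b ∈ 𝒞.fixCylinder u) : ⁅a, b⁆ ∈ 𝒞.localCommutator :=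
  Subgroup.subset_closure ⟨u, hu, a, ha, b, hb, rfl⟩

theorem conj_mem_localCommutator (hT : ∀ x : T, (T.children x).Nonempty) {v m : AAut T}
    (hv : v ∈ 𝒞.V) (hm : m ∈ 𝒞.localCommutator) : v * m * v⁻¹ ∈ 𝒞.localCommutator := by
  induction hm using Subgroup.closure_induction with
  | one => simp
  | mul x y _ _ hx hy =>
    have : v * (x * y) * v⁻¹ = v * x * v⁻¹ * (v * y * v⁻¹) := by group
    rw [this]
    exact mul_mem hx hy
  | inv x _ hx =>
    have : v * x⁻¹ * v⁻¹ = (v * x * v⁻¹)⁻¹ := by group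
    rw [this]
    exact inv_mem hx
  | mem c hc =>
    obtain ⟨u, hu, a, ha, b, hb, rfl⟩ := hc
    obtain ⟨φ, rfl, hφ⟩ := id hv
    obtain ⟨u', hu's, huu'⟩ := exists_ge_mem_of_mem_cofinite hT φ.source_mem_cofinite u
    have hmap : (AAut.mk φ).MapsTo (Ici u')ᶜ (Ici (φ.toPartialEquiv u'))ᶜ := by
      filter_upwards [AAut.rep_mk φ, φ.source_mem_cofinite] with z h1 h2 h3 h4
      rw [h1] at h4
      exact h3 ((φ.le_iff u' hu's z h2).1 h4)
    have hconj : ∀ a ∈ 𝒞.fixCylinder u, AAut.mk φ * a * (AAut.mk φ)⁻¹ ∈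
        𝒞.fixCylinder (φ.toPartialEquiv u') := fun a ha =>
      Subgroup.mem_inf.2 ⟨mul_mem (mul_mem hv ha.1) (inv_mem hv),
        AAut.conj_mem_supportedIn hmap (fixCylinder_mono huu' ha).2⟩
    rw [conj_commutatorElement]
    refine commutator_mem_localCommutator (fun e => ?_) (hconj a ha) (hconj b hb)
    exact ne_bot_of_ne_bot_of_le hu huu' ((hφ u' hu's).1.1 e)

theorem commutator_mul_mem_localCommutator (hT : ∀ x : T, (T.children x).Nonempty)
    {a b c : AAut T} (ha : a ∈ 𝒞.V) (hac : ⁅a, c⁆ ∈ 𝒞.localCommutator)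
    (hbc : ⁅b, c⁆ ∈ 𝒞.localCommutator) : ⁅a * b, c⁆ ∈ 𝒞.localCommutator := by
  have : ⁅a * b, c⁆ = a * ⁅b, c⁆ * a⁻¹ * ⁅a, c⁆ := by
    simp only [commutatorElement_def]
    group
  rw [this]
  exact mul_mem (conj_mem_localCommutator hT ha hbc) hac

theorem commutator_mem_symm {G : Type*} [Group G] {M : Subgroup G} {a b : G} (h : ⁅a, b⁆ ∈ M) :
    ⁅b, a⁆ ∈ M := by
  rw [← commutatorElement_inv]
  exact inv_mem h

theorem localCommutator_le_V : 𝒞.localCommutator ≤ 𝒞.V := by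
  refine (Subgroup.closure_le _).2 ?_
  rintro _ ⟨u, -, a, ha, b, hb, rfl⟩
  exact mul_mem (mul_mem (mul_mem ha.1 hb.1) (inv_mem ha.1)) (inv_mem hb.1)

theorem commutator_mem_of_mul_mem (hT : ∀ x : T, (T.children x).Nonempty) {m a c : AAut T}
    (hm : m ∈ 𝒞.localCommutator) (hc : c ∈ 𝒞.V) (h : ⁅m * a, c⁆ ∈ 𝒞.localCommutator) :
    ⁅a, c⁆ ∈ 𝒞.localCommutator := by
  have h1 : ⁅m⁻¹, c⁆ ∈ 𝒞.localCommutator := by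
    have : ⁅m⁻¹, c⁆ = m⁻¹ * (c * m * c⁻¹) := by
      simp only [commutatorElement_def]
      group
    rw [this]
    exact mul_mem (inv_mem hm) (conj_mem_localCommutator hT hc hm)
  have := commutator_mul_mem_localCommutator hT (inv_mem (localCommutator_le_V hm)) h1 h
  rwa [inv_mul_cancel_left] at this

theorem mapsTo_compl_of_mapsTo_offPath {g : AAut T} {u : T} {B : Set T}
    (h : g.MapsTo (⋃ y ∈ (finite_offPath u).toFinset, Ici y) B) : g.MapsTo (Ici u)ᶜ B := by
  filter_upwards [h, show (Iic u)ᶜ ∈ cofinite by simpa using finite_Iic u] with z hz hzu hzu'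
  obtain ⟨y, hy, hyz⟩ := mem_iUnion_offPath (disjoint_Ici_iff.2 ⟨hzu', hzu⟩)
  exact hz (mem_biUnion ((Finite.mem_toFinset _).2 hy) hyz)

theorem pairwiseDisjoint_toFinset_offPath (u : T) :
    ((finite_offPath u).toFinset : Set T).PairwiseDisjoint Ici := by
  rw [Finite.coe_toFinset]
  exact pairwiseDisjoint_offPath u

theorem disjoint_of_mem_toFinset_offPath {u w : T} (h : u ≤ w) :
    ∀ y ∈ (finite_offPath u).toFinset, Disjoint (Ici y) (Ici w) := fun _ hy =>
  disjoint_Ici_mono (disjoint_of_mem_offPath ((Finite.mem_toFinset _).1 hy)) le_rfl h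

omit [T.IsLocallyFinite] in
theorem exists_common_disjoint (𝒞 : T.ColouringStructure L K)
    (hnc : ∃ x : T, x ≠ ⊥ ∧ (T.children x).Nontrivial) (u v : T) :
    ∃ x y t, u ≤ x ∧ v ≤ y ∧ Disjoint (Ici x) (Ici t) ∧ Disjoint (Ici y) (Ici t) := by
  by_cases huv : u ≤ v
  · obtain ⟨a, b, c, ha, hb, -, -, hac, hbc⟩ := 𝒞.exists_triple_above hnc v
    exact ⟨a, b, c, huv.trans ha, hb, hac, hbc⟩
  · by_cases hvu : v ≤ u
    · obtain ⟨a, b, c, ha, hb, -, -, hac, hbc⟩ := 𝒞.exists_triple_above hnc u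
      exact ⟨a, b, c, ha, hvu.trans hb, hac, hbc⟩
    · obtain ⟨a, b, ha, hb, hab⟩ := 𝒞.exists_pair_above hnc u
      exact ⟨a, v, b, ha, le_rfl, hab,
        (disjoint_Ici_mono (disjoint_Ici_iff.2 ⟨huv, hvu⟩) hb le_rfl).symm⟩

variable (hnc : ∃ x : T, x ≠ ⊥ ∧ (T.children x).Nontrivial)

include hnc
/-- Modulo commutators of elements with small support, the support of an element that fixes the
cylinder of `u` can be moved into any cylinder inside of that of `u`. -/
theorem exists_mul_mem_supportedIn {u w : T} (hu : u ≠ ⊥) (huw : u ≤ w) {a : AAut T}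
    (ha : a ∈ 𝒞.fixCylinder u) :
    ∃ m ∈ 𝒞.localCommutator, m * a ∈ 𝒞.V ∧ m * a ∈ AAut.supportedIn (Ici w) := by
  obtain ⟨w₁, w₂, h1, h2, h12⟩ := 𝒞.exists_pair_above hnc w
  have h1' := huw.trans h1
  obtain ⟨s, hsV, hs, hsm⟩ := exists_move (𝒞 := 𝒞) hnc _ (pairwiseDisjoint_toFinset_offPath u) w₁
    (ne_bot_of_ne_bot_of_le hu h1') (disjoint_of_mem_toFinset_offPath h1')
  have hsW : s ∈ 𝒞.fixCylinder w₂ := by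
    refine mem_fixCylinder hsV hs (disjoint_union_left.2 ⟨?_, h12⟩)
    simp only [disjoint_iUnion_left]
    exact disjoint_of_mem_toFinset_offPath (huw.trans h2)
  have hua : a ∈ 𝒞.fixCylinder w₂ := fixCylinder_mono (huw.trans h2) ha
  refine ⟨⁅s, a⁆, commutator_mem_localCommutator (ne_bot_of_disjoint_Ici h12.symm) hsW hua, ?_⟩
  have e : ⁅s, a⁆ * a = s * a * s⁻¹ := by simp only [commutatorElement_def, inv_mul_cancel_right]
  rw [e]
  exact ⟨mul_mem (mul_mem hsV ha.1) (inv_mem hsV), AAut.supportedIn_mono (Ici_subset_Ici.2 h1)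
    (AAut.conj_mem_supportedIn (mapsTo_compl_of_mapsTo_offPath hsm) ha.2)⟩

/-- Moving the supports of `a` and `b` into small cylinders does not change `⁅a, b⁆` modulo local
commutators, and small cylinders miss a third one. -/
theorem commutator_mem_of_mem_fixCylinder {u v : T} (hu : u ≠ ⊥) (hv : v ≠ ⊥) {a b : AAut T}
    (ha : a ∈ 𝒞.fixCylinder u) (hb : b ∈ 𝒞.fixCylinder v) : ⁅a, b⁆ ∈ 𝒞.localCommutator := by
  have hT := 𝒞.exists_child hnc
  obtain ⟨x, y, t, hux, hvy, hxt, hyt⟩ := 𝒞.exists_common_disjoint hnc u v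
  obtain ⟨m, hm, haV, ham⟩ := exists_mul_mem_supportedIn hnc hu hux ha
  obtain ⟨n, hn, hbV, hbn⟩ := exists_mul_mem_supportedIn hnc hv hvy hb
  have h := commutator_mem_localCommutator (ne_bot_of_disjoint_Ici hxt.symm)
    (mem_fixCylinder haV ham hxt) (mem_fixCylinder hbV hbn hyt)
  have h1 := commutator_mem_of_mul_mem hT hm hbV h
  exact commutator_mem_symm (commutator_mem_of_mul_mem hT hn ha.1 (commutator_mem_symm h1))

/-- If `v` moves the cylinder of `x` off itself, then the product of `v` with the involution that
agrees with `v` on this cylinder is the identity there. -/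
theorem exists_eq_mul_of_mem_V {v : AAut T} (hv : v ∈ 𝒞.V) : ∃ a b : AAut T, ∃ x y : T,
    x ≠ ⊥ ∧ y ≠ ⊥ ∧ a ∈ 𝒞.fixCylinder x ∧ b ∈ 𝒞.fixCylinder y ∧ v = a * b := by
  by_cases hv1 : v = 1
  · obtain ⟨x, hx, -⟩ := hnc
    exact ⟨1, 1, x, x, hx, hx, one_mem _, one_mem _, by simpa using hv1⟩
  have hT := 𝒞.exists_child hnc
  obtain ⟨φ, rfl, hφ⟩ := id hv
  obtain ⟨x, hx, hd⟩ := AAut.exists_disjoint_of_ne_one (𝒞.exists_branching_above hnc) hv1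
  obtain ⟨x₁, x₂, h1, h2, h12⟩ := 𝒞.exists_pair_above hnc x
  have hx1 := φ.isUpperSet_source h1 hx
  have hle := (φ.le_iff x hx x₁ hx1).2 h1
  have h0 : x₁ ≠ ⊥ := ne_bot_of_disjoint_Ici h12
  have hst : 𝒞.SameType x₁ (φ.toPartialEquiv x₁) := by
    have h0' : φ.toPartialEquiv x₁ ≠ ⊥ := fun e => h0 ((hφ x₁ hx1).1.1 e)
    obtain ⟨y, hy⟩ := hT x₁
    exact ⟨h0, h0', (label_eq_of_ccol_eq h0' h0 (φ.covBy hx1 hy) hy ((hφ x₁ hx1).2 h0 y hy)).1.symm⟩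
  have htr : ∀ z, x₁ ≤ z → 𝒞.transport x₁ (φ.toPartialEquiv x₁) z = φ.toPartialEquiv z := by
    intro z hz
    refine hst.transport_eq ?_
    revert hz
    refine tree_induction (p := fun z => x₁ ≤ z →
      𝒞.Corr x₁ (φ.toPartialEquiv x₁) z (φ.toPartialEquiv z)) ?_ ?_ z
    · intro h
      exact absurd (le_bot_iff.1 h) h0
    · intro c d hcd ih hxd
      rcases hxd.eq_or_lt with rfl | hlt
      · exact .base
      · have hxc := le_of_lt_covBy hcd hlt
        have hc := φ.isUpperSet_source hxc hx1
        exact (ih hxc).step hcd (φ.covBy hc hcd)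
          ((hφ c hc).2 (ne_bot_of_ne_bot_of_le h0 hxc) d hcd).symm
  obtain ⟨s, hsV, hs, -, hst⟩ := exists_swap hT hst (disjoint_Ici_mono hd h1 hle)
  refine ⟨s, s⁻¹ * AAut.mk φ, x₂, x₁, ne_bot_of_disjoint_Ici h12.symm, h0, ?_, ?_, by group⟩
  · exact mem_fixCylinder hsV hs (disjoint_union_left.2 ⟨h12, (disjoint_Ici_mono hd h2 hle).symm⟩)
  · refine Subgroup.mem_inf.2 ⟨mul_mem (inv_mem hsV) hv, AAut.mem_supportedIn.2 ?_⟩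
    filter_upwards [AAut.rep_mul s⁻¹ (AAut.mk φ), AAut.rep_mk φ, hst, AAut.rep_inv_rep s]
      with z e1 e2 e3 e4 hz
    rw [mem_compl_iff, not_not, mem_Ici] at hz
    rw [e1, e2, ← htr z hz, ← e3 hz, e4]

theorem commutator_V_le_localCommutator : ⁅𝒞.V, 𝒞.V⁆ ≤ 𝒞.localCommutator := by
  have hT := 𝒞.exists_child hnc
  have key : ∀ u : T, u ≠ ⊥ → ∀ a ∈ 𝒞.fixCylinder u, ∀ v ∈ 𝒞.V, ⁅v, a⁆ ∈ 𝒞.localCommutator := by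
    intro u hu a ha v hv
    obtain ⟨b, c, x, y, hx, hy, hb, hc, rfl⟩ := exists_eq_mul_of_mem_V hnc hv
    exact commutator_mul_mem_localCommutator hT hb.1
      (commutator_mem_of_mem_fixCylinder hnc hx hu hb ha)
      (commutator_mem_of_mem_fixCylinder hnc hy hu hc ha)
  refine Subgroup.commutator_le.2 fun v hv v' hv' => ?_
  obtain ⟨b, c, x, y, hx, hy, hb, hc, rfl⟩ := exists_eq_mul_of_mem_V hnc hv
  exact commutator_mul_mem_localCommutator hT hb.1
    (commutator_mem_symm (key x hx b hb v' hv')) (commutator_mem_symm (key y hy c hc v' hv'))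

/-! ### Subgroups normalized by the commutator subgroup -/

theorem exists_commutator_move_compl {u y : T} (hu : u ≠ ⊥) (hy : y ≠ ⊥) :
    ∃ d ∈ ⁅𝒞.V, 𝒞.V⁆, d.MapsTo (Ici u)ᶜ (Ici y) := by
  have h : ∀ w, u ≤ w → ∃ d ∈ ⁅𝒞.V, 𝒞.V⁆, d.MapsTo (Ici u)ᶜ (Ici w) := by
    intro w huw
    obtain ⟨d, hd, hdm⟩ := exists_commutator_move (𝒞 := 𝒞) hnc _
      (pairwiseDisjoint_toFinset_offPath u) (ne_bot_of_ne_bot_of_le hu huw)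
      (disjoint_of_mem_toFinset_offPath huw)
    exact ⟨d, hd, mapsTo_compl_of_mapsTo_offPath hdm⟩
  by_cases huy : u ≤ y
  · exact h y huy
  · obtain ⟨d, hd, hdm⟩ := h u le_rfl
    by_cases hyu : y ≤ u
    · exact ⟨d, hd, hdm.mono subset_rfl (Ici_subset_Ici.2 hyu)⟩
    · obtain ⟨e, he, hem⟩ := exists_commutator_move (𝒞 := 𝒞) hnc {u} (by simp) hy
        (by simpa using disjoint_Ici_iff.2 ⟨huy, hyu⟩)
      exact ⟨e * d, mul_mem he hd, (hem.mono (by simp) subset_rfl).mul hdm⟩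

section Normalized

variable {N : Subgroup (AAut T)} (hN : ∀ d ∈ ⁅𝒞.V, 𝒞.V⁆, ∀ n ∈ N, d * n * d⁻¹ ∈ N)

include hN

/-- If `g` moves the cylinder of `x` off itself, then `⁅a, b⁆ = ⁅⁅a, g⁆, b⁆` for all `a` and `b`
supported in this cylinder. -/
theorem commutator_mem_of_disjoint {g : AAut T} (hg : g ∈ N) {x y : T}
    (hgm : g.MapsTo (Ici x) (Ici y)) (hd : Disjoint (Ici x) (Ici y)) {a b : AAut T}
    (ha : a ∈ ⁅𝒞.V, 𝒞.V⁆) (hb : b ∈ ⁅𝒞.V, 𝒞.V⁆) (hax : a ∈ AAut.supportedIn (Ici x))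
    (hbx : b ∈ AAut.supportedIn (Ici x)) : ⁅a, b⁆ ∈ N := by
  have hk := AAut.conj_mem_supportedIn hgm (inv_mem hax)
  have hcomm := AAut.commute_of_disjoint (𝒞.exists_child hnc) hk hbx hd.symm
  rw [← commutatorElement_mul_left_of_commute hcomm]
  have hn : a * (g * a⁻¹ * g⁻¹) ∈ N := by
    have : a * (g * a⁻¹ * g⁻¹) = a * g * a⁻¹ * g⁻¹ := by group
    rw [this]
    exact mul_mem (hN a ha g hg) (inv_mem hg)
  have e : ∀ n : AAut T, ⁅n, b⁆ = n * (b * n⁻¹ * b⁻¹) := fun n => by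
    simp only [commutatorElement_def, mul_assoc]
  rw [e]
  exact mul_mem hn (hN b hb _ (inv_mem hn))

/-- With `s` and `t` exchanging the cylinder of `y` with two other cylinders inside that of `x`,
`⁅a, b⁆ = ⁅⁅a, s⁆, ⁅b, t⁆⁆` for all `a` and `b` supported in the cylinder of `y`. -/
theorem exists_commutator_mem {g : AAut T} (hg : g ∈ N) (hg1 : g ≠ 1) :
    ∃ y : T, y ≠ ⊥ ∧ ∀ a ∈ 𝒞.V, ∀ b ∈ 𝒞.V, a ∈ AAut.supportedIn (Ici y) →
      b ∈ AAut.supportedIn (Ici y) → ⁅a, b⁆ ∈ N := by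
  have hT := 𝒞.exists_child hnc
  obtain ⟨φ, rfl⟩ := AAut.exists_rep g
  obtain ⟨x, hx, hd⟩ := AAut.exists_disjoint_of_ne_one (𝒞.exists_branching_above hnc) hg1
  have hx0 := ne_bot_of_disjoint_Ici hd
  obtain ⟨y, p, q, hxy, hxp, hxq, hyp, hyq, hpq⟩ := 𝒞.exists_triple_above hnc x
  obtain ⟨p', hp', hlp⟩ := 𝒞.exists_label_above (ne_bot_of_ne_bot_of_le hx0 hxp) (𝒞.label y)
  obtain ⟨q', hq', hlq⟩ := 𝒞.exists_label_above (ne_bot_of_ne_bot_of_le hx0 hxq) (𝒞.label y)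
  have hy0 := ne_bot_of_ne_bot_of_le hx0 hxy
  have hyp' := disjoint_Ici_mono hyp le_rfl hp'
  have hyq' := disjoint_Ici_mono hyq le_rfl hq'
  have hpq' := disjoint_Ici_mono hpq hp' hq'
  obtain ⟨s, hsV, -, hsm, -⟩ := exists_swap (𝒞 := 𝒞) hT
    ⟨hy0, ne_bot_of_disjoint_Ici hyp'.symm, hlp.symm⟩ hyp'
  obtain ⟨t, htV, -, htm, -⟩ := exists_swap (𝒞 := 𝒞) hT
    ⟨hy0, ne_bot_of_disjoint_Ici hyq'.symm, hlq.symm⟩ hyq'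
  refine ⟨y, hy0, fun a haV b hbV ha hb => ?_⟩
  have hk := AAut.conj_mem_supportedIn hsm (inv_mem ha)
  have hk' := AAut.conj_mem_supportedIn htm (inv_mem hb)
  have e : ∀ a s : AAut T, a * (s * a⁻¹ * s⁻¹) = ⁅a, s⁆ := fun a s => by
    simp only [commutatorElement_def, mul_assoc]
  have hxp' := Ici_subset_Ici.2 (hxp.trans hp')
  have hxq' := Ici_subset_Ici.2 (hxq.trans hq')
  have hxy' := Ici_subset_Ici.2 hxy
  have h1 : ⁅a * (s * a⁻¹ * s⁻¹), b * (t * b⁻¹ * t⁻¹)⁆ = ⁅a, b⁆ := by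
    rw [commutatorElement_mul_right_of_commute, commutatorElement_mul_left_of_commute]
    · exact AAut.commute_of_disjoint hT hk hb hyp'.symm
    · exact (AAut.commute_of_disjoint hT hk' ha hyq'.symm).mul_right
        (AAut.commute_of_disjoint hT hk' hk hpq'.symm)
  rw [← h1]
  refine commutator_mem_of_disjoint hnc hN hg (AAut.mapsTo_mk hx) hd ?_ ?_
    (mul_mem (AAut.supportedIn_mono hxy' ha) (AAut.supportedIn_mono hxp' hk))
    (mul_mem (AAut.supportedIn_mono hxy' hb) (AAut.supportedIn_mono hxq' hk'))
  · rw [e]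
    exact Subgroup.commutator_mem_commutator haV hsV
  · rw [e]
    exact Subgroup.commutator_mem_commutator hbV htV

/-- A nontrivial group of almost automorphisms that is normalized by the commutator subgroup of
`V_𝒞` contains this commutator subgroup. -/
theorem commutator_V_le_of_normalized {g : AAut T} (hg : g ∈ N) (hg1 : g ≠ 1) :
    ⁅𝒞.V, 𝒞.V⁆ ≤ N := by
  refine (commutator_V_le_localCommutator hnc).trans ((Subgroup.closure_le _).2 ?_)
  rintro _ ⟨u, hu, a, ha, b, hb, rfl⟩
  obtain ⟨y, hy, H⟩ := exists_commutator_mem hnc hN hg hg1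
  obtain ⟨d, hd, hdm⟩ := exists_commutator_move_compl (𝒞 := 𝒞) hnc hu hy
  have hdV : d ∈ 𝒞.V := Subgroup.commutator_le_self _ hd
  have h := H _ (mul_mem (mul_mem hdV ha.1) (inv_mem hdV)) _
    (mul_mem (mul_mem hdV hb.1) (inv_mem hdV)) (AAut.conj_mem_supportedIn hdm ha.2)
    (AAut.conj_mem_supportedIn hdm hb.2)
  rw [← conj_commutatorElement] at h
  have := hN _ (inv_mem hd) _ h
  have e : d⁻¹ * (d * ⁅a, b⁆ * d⁻¹) * d⁻¹⁻¹ = ⁅a, b⁆ := by group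
  rwa [e] at this

end Normalized

theorem exists_commutator_V_ne_one : ∃ d ∈ ⁅𝒞.V, 𝒞.V⁆, d ≠ 1 := by
  obtain ⟨x, hx, -⟩ := id hnc
  obtain ⟨y, w, -, hxw, hyw⟩ := 𝒞.exists_pair_above hnc x
  obtain ⟨d, hd, hdm⟩ := exists_commutator_move (𝒞 := 𝒞) hnc {y} (by simp)
    (ne_bot_of_ne_bot_of_le hx hxw) (by simpa using hyw)
  refine ⟨d, hd, ?_⟩
  rintro rfl
  obtain ⟨z, ⟨h1, h2⟩, hyz⟩ :=
    exists_ge_mem_of_mem_cofinite (𝒞.exists_child hnc) (hdm.and AAut.rep_one) y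
  have := h1 (by simpa using hyz)
  rw [h2] at this
  exact Set.disjoint_left.1 hyw hyz this

end ColouringStructure

end Simplicity

end RootedTree

theorem proposition4p6 (T : RootedTree.{u}) [T.IsLocallyFinite] {L : Type v} [Finite L] {K : Type w}
    (𝒞 : T.ColouringStructure L K)
    (hnc : ∃ x : T, x ≠ ⊥ ∧ (T.children x).Nontrivial)
    (P : RootedTree.Patterning 𝒞) :
    (⁅(⊤ : Subgroup P.AAutP), (⊤ : Subgroup P.AAutP)⁆).topologicalClosure =
        (⁅𝒞.V.subgroupOf P.AAutP, 𝒞.V.subgroupOf P.AAutP⁆).topologicalClosure ∧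
      IsTopologicallySimple
        ↥(⁅(⊤ : Subgroup P.AAutP), (⊤ : Subgroup P.AAutP)⁆).topologicalClosure := by
  have hcl := RootedTree.topologicalClosure_commutator_of_dense (P.dense_V hnc)
  refine ⟨hcl, ?_⟩
  rw [hcl]
  have hmap : ⁅𝒞.V.subgroupOf P.AAutP, 𝒞.V.subgroupOf P.AAutP⁆.map P.AAutP.subtype =
      ⁅𝒞.V, 𝒞.V⁆ := by
    rw [Subgroup.map_commutator, Subgroup.map_subgroupOf_eq_of_le (P.V_le_AAutP hnc)]
  generalize ⁅𝒞.V.subgroupOf P.AAutP, 𝒞.V.subgroupOf P.AAutP⁆ = D at hmap ⊢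
  have hle : D ≤ D.topologicalClosure := Subgroup.le_topologicalClosure _
  refine ⟨?_, fun N hNn hNc => ?_⟩
  · obtain ⟨d, hd, hd1⟩ := RootedTree.ColouringStructure.exists_commutator_V_ne_one (𝒞 := 𝒞) hnc
    rw [← hmap] at hd
    obtain ⟨d', hd', rfl⟩ := hd
    refine ⟨⟨d', hle hd'⟩, 1, fun e => hd1 ?_⟩
    have e' : d' = 1 := congrArg Subtype.val e
    rw [e', map_one]
  · refine or_iff_not_imp_left.2 fun hN => ?_
    obtain ⟨g, hg, hg1⟩ := N.bot_or_exists_ne_one.resolve_left hN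
    have hDN : D ≤ N.map D.topologicalClosure.subtype := by
      have key : ⁅𝒞.V, 𝒞.V⁆ ≤ (N.map D.topologicalClosure.subtype).map P.AAutP.subtype := by
        refine RootedTree.ColouringStructure.commutator_V_le_of_normalized
          (g := ((g : P.AAutP) : RootedTree.AAut T)) hnc ?_ ⟨_, ⟨g, hg, rfl⟩, rfl⟩
          fun e => hg1 (Subtype.ext (Subtype.ext e))
        rintro d hd _ ⟨_, ⟨n, hn, rfl⟩, rfl⟩
        rw [← hmap] at hd
        obtain ⟨d', hd', rfl⟩ := hd
        exact ⟨_, ⟨_, hNn.conj_mem n hn ⟨d', hle hd'⟩, rfl⟩, rfl⟩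
      rw [← hmap] at key
      exact (Subgroup.map_le_map_iff_of_injective P.AAutP.subtype_injective).1 key
    have hcl' : IsClosed (N.map D.topologicalClosure.subtype : Set P.AAutP) := by
      rw [Subgroup.coe_map]
      exact (Subgroup.isClosed_topologicalClosure D).isClosedEmbedding_subtypeVal.isClosedMap _ hNc
    refine eq_top_iff.2 fun h _ => ?_
    obtain ⟨n, hn, e⟩ := Subgroup.topologicalClosure_minimal _ hDN hcl' h.2
    rwa [← Subtype.ext e]
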